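/- Let $\mathbb{C}^3$ carry its flat metric $\langle\cdot,\cdot\rangle$, complex structure $J$, Kähler form $\omega=\frac{i}{2}\sum_j dz_j\wedge d\bar z_j$ and holomorphic volume form $\Upsilon=dz_1\wedge dz_2\wedge dz_3$. A smooth immersion $f:L\to\mathbb{C}^3$ of a smooth $3$-manifold (for example the inclusion of a submanifold) is special Lagrangian if $f^*\omega=0$ and $f^*(\operatorname{Im}\Upsilon)=0$; a special Lagrangian $3$-plane is an affine real $3$-plane in $\mathbb{C}^3$ on which $\omega$ and $\operatorname{Im}\Upsilon$ vanish. The fundamental cubic of such an $f$ at $x\in L$ is the cubic form $C_x(v)=\langle \mathrm{I\!I}_x(v,v),J\,df_x(v)\rangle$ on $T_xL$, where $\mathrm{I\!I}$ is the second fundamental form, and $C_x$ is said to have an $A_4$-symmetry if its stabilizer in $\operatorname{SO}(T_xL)$ (with respect to the induced metric) contains a subgroup isomorphic to the alternating group $A_4$. Theorem. Let $L$ be a connected smooth $3$-manifold and let $f:L\to\mathbb{C}^3$ be a special Lagrangian immersion. Then the fundamental cubic of $f$ has an $A_4$-symmetry at every point of $L$ if and only if $f(L)$ is contained in, and is a relatively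 open subset of, a special Lagrangian $3$-plane. -/

import Mathlib

open scoped Manifold ContDiff

noncomputable section

namespace SpecialLagrangian

/-- The model space of smooth (boundaryless) 3-manifolds. -/
abbrev RThree : Type := EuclideanSpace ℝ (Fin 3)

/-- Complex 3-space. As a real vector space it carries the standard Euclidean inner product
`⟪v, w⟫ = Re ∑ conj (v j) * w j`. -/
abbrev CThree : Type := EuclideanSpace ℂ (Fin 3)

/-- The standard Kähler form `(i/2) ∑ dz_j ∧ dz̄_j = ∑ dx_j ∧ dy_j` of complex 3-space. -/
def kahlerForm (v w : CThree) : ℝ :=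
  ∑ j, ((v j).re * (w j).im - (v j).im * (w j).re)

/-- The standard holomorphic volume form `dz_1 ∧ dz_2 ∧ dz_3` of complex 3-space. -/
def volumeForm (u v w : CThree) : ℂ :=
  Matrix.det (Matrix.of fun i j : Fin 3 => (![u, v, w] i) j)

/-- The complex structure `J`, multiplication by `i`. -/
def complexStructure (v : CThree) : CThree := Complex.I • v

/-- A real linear subspace of complex 3-space is special Lagrangian if it has real dimension 3 and
both the Kähler form and the imaginary part of the holomorphic volume form vanish on it. -/
def IsSpecialLagrangianSubspace (V : Submodule ℝ CThree) : Prop :=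
  Module.finrank ℝ V = 3 ∧
    (∀ v ∈ V, ∀ w ∈ V, kahlerForm v w = 0) ∧
    (∀ u ∈ V, ∀ v ∈ V, ∀ w ∈ V, (volumeForm u v w).im = 0)

/-- A special Lagrangian 3-plane: a (nonempty) real affine subspace of complex 3-space whose
direction is special Lagrangian. -/
def IsSpecialLagrangianPlane (P : AffineSubspace ℝ CThree) : Prop :=
  (P : Set CThree).Nonempty ∧ IsSpecialLagrangianSubspace P.direction

variable {M : Type*} [TopologicalSpace M] [ChartedSpace RThree M]

/-- The differential of `f` at `x`, as a real linear map from `T_x M` to complex 3-space. -/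
def differential (f : M → CThree) (x : M) : TangentSpace (𝓡 3) x →L[ℝ] CThree :=
  mfderiv (𝓡 3) 𝓘(ℝ, CThree) f x

/-- The tangent space of the (immersed) submanifold `f` at `x`, inside complex 3-space. -/
def tangentPlane (f : M → CThree) (x : M) : Submodule ℝ CThree :=
  LinearMap.range (differential f x).toLinearMap

/-- `f` is a smooth immersion of a 3-manifold as a special Lagrangian submanifold. -/
structure IsSpecialLagrangianImmersion (f : M → CThree) : Prop where
  smooth : ContMDiff (𝓡 3) 𝓘(ℝ, CThree) ∞ f
  immersive : ∀ x, Function.Injective (differential f x)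
  specialLagrangian : ∀ x, IsSpecialLagrangianSubspace (tangentPlane f x)

/-- The first fundamental form: the metric on `T_x M` induced by `f`. -/
def firstFundamentalForm (f : M → CThree) (x : M) (a b : TangentSpace (𝓡 3) x) : ℝ :=
  inner ℝ (differential f x a) (differential f x b)

/-- The second derivative at `x` of `f`, read in the preferred chart at `x`, which is the chart by
which Mathlib identifies `T_x M` with the model space. Only its normal part is used. -/
def chartHessian (f : M → CThree) (x : M) : TangentSpace (𝓡 3) x → TangentSpace (𝓡 3) x → CThree :=
  fun (a b : RThree) =>
    fderiv ℝ (fderiv ℝ (f ∘ (extChartAt (𝓡 3) x).symm)) (extChartAt (𝓡 3) x x) a b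

/-- The second fundamental form: the component of the second derivative normal to the submanifold
(the ambient connection is flat). -/
def secondFundamentalForm (f : M → CThree) (x : M) (a b : TangentSpace (𝓡 3) x) : CThree :=
  (tangentPlane f x)ᗮ.starProjection (chartHessian f x a b)

/-- The fundamental cubic `C = h_ijk ω_i ω_j ω_k`, where the second fundamental form is
`II = h_ijk J e_i ⊗ ω_j ω_k`; that is, the cubic form `C(a) = ⟪II(a, a), J (df a)⟫` on `T_x M`. -/
def fundamentalCubic (f : M → CThree) (x : M) (a : TangentSpace (𝓡 3) x) : ℝ :=
  inner ℝ (secondFundamentalForm f x a a) (complexStructure (differential f x a))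

/-- The stabilizer of the fundamental cubic at `x` in the group `SO(T_x M)` of orientation
preserving linear isometries of `T_x M` with its induced metric. -/
def cubicStabilizer (f : M → CThree) (x : M) :
    Subgroup (TangentSpace (𝓡 3) x ≃ₗ[ℝ] TangentSpace (𝓡 3) x) where
  carrier := {A |
    (∀ a b, firstFundamentalForm f x (A a) (A b) = firstFundamentalForm f x a b) ∧
    LinearEquiv.det A = 1 ∧
    (∀ a, fundamentalCubic f x (A a) = fundamentalCubic f x a)}
  one_mem' := ⟨fun _ _ => rfl, map_one _, fun _ => rfl⟩
  mul_mem' := by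
    rintro A B ⟨hA, hA', hA''⟩ ⟨hB, hB', hB''⟩
    refine ⟨fun a b => ?_, by rw [map_mul, hA', hB', one_mul], fun a => ?_⟩
    · exact (hA (B a) (B b)).trans (hB a b)
    · exact (hA'' (B a)).trans (hB'' a)
  inv_mem' := by
    rintro A ⟨hA, hA', hA''⟩
    have key : ∀ a, A (A⁻¹ a) = a := fun a => A.apply_symm_apply a
    refine ⟨fun a b => ?_, by rw [map_inv, hA', inv_one], fun a => ?_⟩
    · rw [← hA (A⁻¹ a) (A⁻¹ b), key, key]
    · rw [← hA'' (A⁻¹ a), key]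

/-- The fundamental cubic has an `A₄`-symmetry at `x`: its stabilizer in `SO(T_x M)` contains a
copy of the alternating group on four letters. -/
def HasA4SymmetryAt (f : M → CThree) (x : M) : Prop :=
  ∃ H : Subgroup (TangentSpace (𝓡 3) x ≃ₗ[ℝ] TangentSpace (𝓡 3) x),
    H ≤ cubicStabilizer f x ∧ Nonempty (H ≃* alternatingGroup (Fin 4))

end SpecialLagrangian

end

/-!
Write the immersion near a point `x` as the graph `q ↦ q + i G(q)` over its tangent plane. Since the
image is Lagrangian, `G` is a gradient `∇u`, the induced metric is `g = 1 + (D²u)²`, and the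
fundamental cubic is `D³u` (`exists_linearEquiv_fundamentalCubic`).

If the cubic has an `A₄`-symmetry, the two commuting half-turns generating the Klein four-group in
`A₄` are simultaneously diagonalizable, and in the resulting orthonormal frame invariance kills every
monomial except `x₀ x₁ x₂` (`exists_orthonormal_frame_of_invariant`). Hence the matrices
`g⁻¹ (∂ᵢ∂ⱼ∂ₖ u)ⱼₖ` are traceless, and the traces of their products are proportional to `gᵢⱼ`
(`trace_identities_of_frame`). These identities hold at all points near `x`, so they may be
differentiated. At `x` the Hessian `D²u` vanishes and `D³u` is `s` times the polarization of
`6 x₀ x₁ x₂`. The first derivatives of the identities force `D⁴u = 0` at `x`. Put `A = u₀₀₀₁₂`,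
`B = u₀₁₁₁₂` and `C = u₀₁₂₂₂`. The second derivatives of the trace identities give
`A + B + C = 2 s³`, and those of the quadratic identities give, when `s ≠ 0`,
`A + B = B + C = A + C = 2 s³`. Therefore `s = 0` (`cubic_coefficient_eq_zero`).
In place of moving frames and the Codazzi and Gauss equations, this uses only the symmetry of the
higher derivatives of `u`.

So the cubic vanishes identically. Then `D³u = 0` near `x`, the graph is flat, and the immersion
coincides locally with its affine tangent plane (`eventually_planar`). The affine tangent plane is
thus a locally constant function on the manifold, and by connectedness it is one special Lagrangian
plane, in which the image is open.

Conversely, an immersion into a plane has vanishing second fundamental form, so the stabilizer of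
the cubic is the whole rotation group, which contains the rotations of a regular tetrahedron
(`exists_subgroup_alternatingGroup`).
-/

namespace SpecialLagrangian

open Filter Topology

/-! ### Second-order jets of scalar functions -/

section Jets

variable {E : Type*} [NormedAddCommGroup E] [NormedSpace ℝ E]

/-- The derivative of the scalar function `φ` in the constant direction `v`, as a function. -/
noncomputable def dirDeriv (v : E) (φ : E → ℝ) : E → ℝ := fun p => fderiv ℝ φ p v

theorem dirDeriv_eventuallyEq {φ ψ : E → ℝ} {p : E} (h : φ =ᶠ[𝓝 p] ψ) (v : E) :
    dirDeriv v φ =ᶠ[𝓝 p] dirDeriv v ψ := by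
  filter_upwards [h.fderiv (𝕜 := ℝ)] with q hq
  simp [dirDeriv, hq]

theorem contDiffAt_dirDeriv {φ : E → ℝ} {p : E} {n m : ℕ∞ω} (h : ContDiffAt ℝ n φ p)
    (hmn : m + 1 ≤ n) (v : E) : ContDiffAt ℝ m (dirDeriv v φ) p :=
  (h.fderiv_right hmn).clm_apply contDiffAt_const

theorem dirDeriv_add {φ ψ : E → ℝ} {p : E} (v : E) (hφ : DifferentiableAt ℝ φ p)
    (hψ : DifferentiableAt ℝ ψ p) :
    dirDeriv v (fun q => φ q + ψ q) p = dirDeriv v φ p + dirDeriv v ψ p := by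
  simp [dirDeriv, fderiv_fun_add hφ hψ]

theorem dirDeriv_mul {φ ψ : E → ℝ} {p : E} (v : E) (hφ : DifferentiableAt ℝ φ p)
    (hψ : DifferentiableAt ℝ ψ p) :
    dirDeriv v (fun q => φ q * ψ q) p = dirDeriv v φ p * ψ p + φ p * dirDeriv v ψ p := by
  simp [dirDeriv, fderiv_fun_mul hφ hψ]
  ring

theorem dirDeriv_comm {φ : E → ℝ} {p : E} (h : ContDiffAt ℝ 2 φ p) (v w : E) :
    dirDeriv v (dirDeriv w φ) p = dirDeriv w (dirDeriv v φ) p := by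
  have hd : DifferentiableAt ℝ (fderiv ℝ φ) p :=
    (h.fderiv_right (m := 1) (by norm_num)).differentiableAt (by norm_num)
  have key : ∀ a b : E, dirDeriv a (dirDeriv b φ) p = fderiv ℝ (fderiv ℝ φ) p a b := by
    intro a b
    change fderiv ℝ (fun q => fderiv ℝ φ q b) p a = _
    rw [fderiv_clm_apply hd (differentiableAt_const b)]
    simp
  rw [key, key]
  exact h.isSymmSndFDerivAt (by simp) v w

/-- The part of the second-order Taylor expansion of `φ` at `p` seen by the two directions `v` and
`w`: the value, the two directional derivatives and the mixed second derivative. Sums and products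
of functions act on these quadruples as on `ℝ[ε, η] / (ε², η²)`. -/
structure HasJet (v w : E) (p : E) (φ : E → ℝ) (a b c d : ℝ) : Prop where
  contDiffAt : ContDiffAt ℝ 2 φ p
  val : φ p = a
  fst : dirDeriv v φ p = b
  snd : dirDeriv w φ p = c
  mixed : dirDeriv v (dirDeriv w φ) p = d

namespace HasJet

variable {v w p : E} {φ ψ : E → ℝ} {a b c d a' b' c' d' : ℝ}

theorem of_contDiffAt (h : ContDiffAt ℝ 2 φ p) :
    HasJet v w p φ (φ p) (dirDeriv v φ p) (dirDeriv w φ p) (dirDeriv v (dirDeriv w φ) p) :=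
  ⟨h, rfl, rfl, rfl, rfl⟩

theorem cast (h : HasJet v w p φ a b c d) (ha : a = a') (hb : b = b') (hc : c = c')
    (hd : d = d') : HasJet v w p φ a' b' c' d' := by
  subst ha hb hc hd; exact h

theorem congr (h : HasJet v w p φ a b c d) (e : φ =ᶠ[𝓝 p] ψ) : HasJet v w p ψ a b c d where
  contDiffAt := h.contDiffAt.congr_of_eventuallyEq e.symm
  val := e.eq_of_nhds ▸ h.val
  fst := (dirDeriv_eventuallyEq e v).eq_of_nhds ▸ h.fst
  snd := (dirDeriv_eventuallyEq e w).eq_of_nhds ▸ h.snd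
  mixed := (dirDeriv_eventuallyEq (dirDeriv_eventuallyEq e w) v).eq_of_nhds ▸ h.mixed

theorem const (r : ℝ) : HasJet v w p (fun _ => r) r 0 0 0 := by
  have : ∀ (u : E) (r : ℝ), dirDeriv u (fun _ : E => r) = fun _ => 0 := by
    intro u r; ext q; simp [dirDeriv]
  exact ⟨contDiffAt_const, rfl, by rw [this], by rw [this], by rw [this, this]⟩

theorem add (h : HasJet v w p φ a b c d) (h' : HasJet v w p ψ a' b' c' d') :
    HasJet v w p (fun q => φ q + ψ q) (a + a') (b + b') (c + c') (d + d') := by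
  have d1 := h.contDiffAt.differentiableAt (by norm_num)
  have d2 := h'.contDiffAt.differentiableAt (by norm_num)
  refine ⟨h.contDiffAt.add h'.contDiffAt, by rw [h.val, h'.val],
    by rw [dirDeriv_add v d1 d2, h.fst, h'.fst], by rw [dirDeriv_add w d1 d2, h.snd, h'.snd], ?_⟩
  have e : dirDeriv w (fun q => φ q + ψ q) =ᶠ[𝓝 p] fun q => dirDeriv w φ q + dirDeriv w ψ q := by
    filter_upwards [h.contDiffAt.eventually (by simp), h'.contDiffAt.eventually (by simp)]
      with q hq hq'
    exact dirDeriv_add w (hq.differentiableAt (by norm_num)) (hq'.differentiableAt (by norm_num))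
  rw [(dirDeriv_eventuallyEq e v).eq_of_nhds, dirDeriv_add v, h.mixed, h'.mixed]
  · exact (contDiffAt_dirDeriv h.contDiffAt (m := 1) (by norm_num) w).differentiableAt
      (by norm_num)
  · exact (contDiffAt_dirDeriv h'.contDiffAt (m := 1) (by norm_num) w).differentiableAt
      (by norm_num)

theorem mul (h : HasJet v w p φ a b c d) (h' : HasJet v w p ψ a' b' c' d') :
    HasJet v w p (fun q => φ q * ψ q) (a * a') (b * a' + a * b') (c * a' + a * c')
      (d * a' + c * b' + (b * c' + a * d')) := by
  have d1 := h.contDiffAt.differentiableAt (by norm_num)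
  have d2 := h'.contDiffAt.differentiableAt (by norm_num)
  refine ⟨h.contDiffAt.mul h'.contDiffAt, by rw [h.val, h'.val],
    by rw [dirDeriv_mul v d1 d2, h.fst, h'.fst, h.val, h'.val],
    by rw [dirDeriv_mul w d1 d2, h.snd, h'.snd, h.val, h'.val], ?_⟩
  have e : dirDeriv w (fun q => φ q * ψ q) =ᶠ[𝓝 p]
      fun q => dirDeriv w φ q * ψ q + φ q * dirDeriv w ψ q := by
    filter_upwards [h.contDiffAt.eventually (by simp), h'.contDiffAt.eventually (by simp)]
      with q hq hq'
    exact dirDeriv_mul w (hq.differentiableAt (by norm_num)) (hq'.differentiableAt (by norm_num))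
  have d3 := (contDiffAt_dirDeriv h.contDiffAt (m := 1) (by norm_num) w).differentiableAt
    (by norm_num)
  have d4 := (contDiffAt_dirDeriv h'.contDiffAt (m := 1) (by norm_num) w).differentiableAt
    (by norm_num)
  rw [(dirDeriv_eventuallyEq e v).eq_of_nhds, dirDeriv_add v (d3.fun_mul d2) (d1.fun_mul d4),
    dirDeriv_mul v d3 d2, dirDeriv_mul v d1 d4, h.mixed, h'.mixed, h.val, h'.val, h.fst, h'.fst,
    h.snd, h'.snd]

theorem sub (h : HasJet v w p φ a b c d) (h' : HasJet v w p ψ a' b' c' d') :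
    HasJet v w p (fun q => φ q - ψ q) (a - a') (b - b') (c - c') (d - d') := by
  have := h.add ((const (-1)).mul h')
  refine (this.congr (Eventually.of_forall fun q => ?_)).cast ?_ ?_ ?_ ?_ <;> ring

theorem sum {ι : Type*} (t : Finset ι) {φ : ι → E → ℝ} {a b c d : ι → ℝ}
    (h : ∀ i, HasJet v w p (φ i) (a i) (b i) (c i) (d i)) :
    HasJet v w p (fun q => ∑ i ∈ t, φ i q) (∑ i ∈ t, a i) (∑ i ∈ t, b i) (∑ i ∈ t, c i)
      (∑ i ∈ t, d i) := by
  classical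
  induction t using Finset.induction_on with
  | empty => simpa using const 0
  | insert i t hi ih => simpa only [Finset.sum_insert hi] using (h i).add ih

end HasJet

end Jets

/-! ### The metric of a graph -/

/-- The coefficients of the polarization of `6 x₀ x₁ x₂`: one on triples of distinct indices and
zero on all others. -/
def distinctSymbol (i j k : Fin 3) : ℝ := if i ≠ j ∧ j ≠ k ∧ i ≠ k then 1 else 0

section GraphAlgebra

/-- The induced metric `1 + Uᵀ U` of the graph of a map whose Jacobian is `U`. -/
noncomputable def graphMetric (U : Matrix (Fin 3) (Fin 3) ℝ) : Matrix (Fin 3) (Fin 3) ℝ :=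
  1 + U.transpose * U

variable {E : Type*} [NormedAddCommGroup E] [NormedSpace ℝ E] {p v w : E}

theorem hasJet_graphMetric {U : E → Matrix (Fin 3) (Fin 3) ℝ} {x y z : Matrix (Fin 3) (Fin 3) ℝ}
    (hU : ∀ i j, HasJet v w p (fun q => U q i j) 0 (x i j) (y i j) (z i j)) (i j : Fin 3) :
    HasJet v w p (fun q => graphMetric (U q) i j) ((1 : Matrix (Fin 3) (Fin 3) ℝ) i j) 0 0
      ((x.transpose * y + y.transpose * x) i j) := by
  have h := (HasJet.const (v := v) (w := w) (p := p) ((1 : Matrix (Fin 3) (Fin 3) ℝ) i j)).add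
    (HasJet.sum Finset.univ fun k => (hU k i).mul (hU k j))
  refine (h.congr (Eventually.of_forall fun q => ?_)).cast ?_ ?_ ?_ ?_
  · simp [graphMetric, Matrix.mul_apply]
  · simp
  · simp
  · simp
  · simp [Matrix.mul_apply, Finset.sum_add_distrib, add_comm]

/-- The adjugate of a matrix `1 + εη z` over `ℝ[ε, η] / (ε², η²)` is `1 + εη (tr z - z)`. -/
theorem hasJet_adjugate {g : E → Matrix (Fin 3) (Fin 3) ℝ} {z : Matrix (Fin 3) (Fin 3) ℝ}
    (hg : ∀ i j, HasJet v w p (fun q => g q i j) ((1 : Matrix (Fin 3) (Fin 3) ℝ) i j) 0 0 (z i j))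
    (i j : Fin 3) :
    HasJet v w p (fun q => (g q).adjugate i j) ((1 : Matrix (Fin 3) (Fin 3) ℝ) i j) 0 0
      ((z.trace • (1 : Matrix (Fin 3) (Fin 3) ℝ) - z) i j) := by
  have key : ∀ a b c d a' b' c' d' : Fin 3,
      HasJet v w p (fun q => g q a b * g q c d - g q a' b' * g q c' d') _ _ _ _ :=
    fun a b c d a' b' c' d' => ((hg a b).mul (hg c d)).sub ((hg a' b').mul (hg c' d'))
  have adj : ∀ q, (g q).adjugate = _ := fun q => Matrix.adjugate_fin_three (g q)
  fin_cases i <;> fin_cases j <;> simp only [adj]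
  on_goal 1 => refine ((key 1 1 2 2 1 2 2 1).congr (Eventually.of_forall fun q => ?_)).cast ?_ ?_ ?_ ?_
  on_goal 6 => refine ((key 0 2 2 1 0 1 2 2).congr (Eventually.of_forall fun q => ?_)).cast ?_ ?_ ?_ ?_
  on_goal 11 => refine ((key 0 1 1 2 0 2 1 1).congr (Eventually.of_forall fun q => ?_)).cast ?_ ?_ ?_ ?_
  on_goal 16 => refine ((key 1 2 2 0 1 0 2 2).congr (Eventually.of_forall fun q => ?_)).cast ?_ ?_ ?_ ?_
  on_goal 21 => refine ((key 0 0 2 2 0 2 2 0).congr (Eventually.of_forall fun q => ?_)).cast ?_ ?_ ?_ ?_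
  on_goal 26 => refine ((key 0 2 1 0 0 0 1 2).congr (Eventually.of_forall fun q => ?_)).cast ?_ ?_ ?_ ?_
  on_goal 31 => refine ((key 1 0 2 1 1 1 2 0).congr (Eventually.of_forall fun q => ?_)).cast ?_ ?_ ?_ ?_
  on_goal 36 => refine ((key 0 1 2 0 0 0 2 1).congr (Eventually.of_forall fun q => ?_)).cast ?_ ?_ ?_ ?_
  on_goal 41 => refine ((key 0 0 1 1 0 1 1 0).congr (Eventually.of_forall fun q => ?_)).cast ?_ ?_ ?_ ?_
  all_goals simp [Matrix.trace, Fin.sum_univ_three]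
  all_goals ring

theorem hasJet_matrix_mul {A B : E → Matrix (Fin 3) (Fin 3) ℝ}
    {a₀ a₁ a₂ a₃ b₀ b₁ b₂ b₃ : Matrix (Fin 3) (Fin 3) ℝ}
    (hA : ∀ i j, HasJet v w p (fun q => A q i j) (a₀ i j) (a₁ i j) (a₂ i j) (a₃ i j))
    (hB : ∀ i j, HasJet v w p (fun q => B q i j) (b₀ i j) (b₁ i j) (b₂ i j) (b₃ i j))
    (i j : Fin 3) :
    HasJet v w p (fun q => (A q * B q) i j) ((a₀ * b₀) i j) ((a₁ * b₀ + a₀ * b₁) i j)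
      ((a₂ * b₀ + a₀ * b₂) i j) ((a₃ * b₀ + a₂ * b₁ + (a₁ * b₂ + a₀ * b₃)) i j) := by
  have h := HasJet.sum Finset.univ fun k => (hA i k).mul (hB k j)
  refine (h.congr (Eventually.of_forall fun q => ?_)).cast ?_ ?_ ?_ ?_ <;>
  simp [Matrix.mul_apply, Finset.sum_add_distrib]

theorem hasJet_trace {A : E → Matrix (Fin 3) (Fin 3) ℝ} {a₀ a₁ a₂ a₃ : Matrix (Fin 3) (Fin 3) ℝ}
    (hA : ∀ i j, HasJet v w p (fun q => A q i j) (a₀ i j) (a₁ i j) (a₂ i j) (a₃ i j)) :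
    HasJet v w p (fun q => (A q).trace) a₀.trace a₁.trace a₂.trace a₃.trace :=
  HasJet.sum Finset.univ fun i => hA i i

end GraphAlgebra

/-! ### Prolongation of the trace identities -/

section Prolongation

/-- A quartic form with coefficients `K` that is harmonic and satisfies the first derivatives of the
off-diagonal quadratic identities at a multiple of `x₀ x₁ x₂` is zero. -/
theorem quartic_eq_zero {K : Fin 3 → Fin 3 → Fin 3 → Fin 3 → ℝ}
    (s12 : ∀ i j k l, K i j k l = K j i k l) (s23 : ∀ i j k l, K i j k l = K i k j l)
    (s34 : ∀ i j k l, K i j k l = K i j l k)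
    (htr : ∀ i l, K i 0 0 l + K i 1 1 l + K i 2 2 l = 0)
    (h0 : ∀ l, K 1 1 0 l + K 2 2 0 l = 0) (h1 : ∀ l, K 0 0 1 l + K 2 2 1 l = 0)
    (h2 : ∀ l, K 0 0 2 l + K 1 1 2 l = 0) (i j k l : Fin 3) :
    K i j k l = 0 := by
  have a00 := htr 0 0
  have a01 := htr 0 1
  have a02 := htr 0 2
  have a10 := htr 1 0
  have a11 := htr 1 1
  have a12 := htr 1 2
  have a20 := htr 2 0
  have a21 := htr 2 1
  have a22 := htr 2 2
  have b00 := h0 0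
  have b01 := h0 1
  have b02 := h0 2
  have b10 := h1 0
  have b11 := h1 1
  have b12 := h1 2
  have b20 := h2 0
  have b21 := h2 1
  have b22 := h2 2
  simp only [s12, s23, s34] at a00 a01 a02 a10 a11 a12 a20 a21 a22 b00 b01 b02 b10 b11 b12 b20 b21 b22
  have cases3 : ∀ r : Fin 3, r = 0 ∨ r = 1 ∨ r = 2 := by decide
  rcases cases3 i with rfl | rfl | rfl <;> rcases cases3 j with rfl | rfl | rfl <;>
  rcases cases3 k with rfl | rfl | rfl <;> rcases cases3 l with rfl | rfl | rfl <;>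
  (try simp only [s12, s23, s34]) <;> linarith

variable {E : Type*} [NormedAddCommGroup E] [NormedSpace ℝ E]

/-- For the graph of a map with Jacobian `U`, the matrix `∂ₖ Uᵢⱼ` of second derivatives of the
`i`-th component, where `∂ₖ` is the derivative in the direction `e k`. -/
noncomputable def componentHessian (e : Fin 3 → E) (U : E → Matrix (Fin 3) (Fin 3) ℝ) (i : Fin 3)
    (q : E) : Matrix (Fin 3) (Fin 3) ℝ :=
  Matrix.of fun j k => dirDeriv (e k) (fun r => U r i j) q

/-- The second derivatives of the `i`-th component with one index raised by the induced metric `g`,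
multiplied by `det g`. Working with the adjugate of `g` in place of its inverse keeps everything
polynomial in the derivatives of the map. -/
noncomputable def shapeMatrix (e : Fin 3 → E) (U : E → Matrix (Fin 3) (Fin 3) ℝ) (i : Fin 3)
    (q : E) : Matrix (Fin 3) (Fin 3) ℝ :=
  (graphMetric (U q)).adjugate * componentHessian e U i q

/-- If the graph of a gradient map, tangent to the horizontal plane at `p`, has at all points near
`p` a cubic that is a multiple of `x₀ x₁ x₂` in some orthonormal frame, expressed by the trace
identities `htr` and `hquad`, then this multiple is zero at `p`. Differentiating the identities once
kills the fourth derivatives of the potential; the second derivatives of the identities impose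
contradictory conditions on three of its fifth derivatives unless `s = 0`. -/
theorem cubic_coefficient_eq_zero {e : Fin 3 → E} {U : E → Matrix (Fin 3) (Fin 3) ℝ} {p : E} {s : ℝ}
    (hU : ∀ i j, ContDiffAt ℝ 3 (fun q => U q i j) p)
    (hsymm : ∀ i j, (fun q => U q i j) =ᶠ[𝓝 p] fun q => U q j i)
    (hclosed : ∀ i j k, dirDeriv (e k) (fun q => U q i j) =ᶠ[𝓝 p]
      dirDeriv (e j) (fun q => U q i k))
    (h0 : U p = 0)
    (hcubic : ∀ i j k, dirDeriv (e k) (fun q => U q i j) p = s * distinctSymbol i j k)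
    (htr : ∀ i, ∀ᶠ q in 𝓝 p, (shapeMatrix e U i q).trace = 0)
    (hquad : ∀ i j a b, ∀ᶠ q in 𝓝 p,
      graphMetric (U q) a b * (shapeMatrix e U i q * shapeMatrix e U j q).trace =
        graphMetric (U q) i j * (shapeMatrix e U a q * shapeMatrix e U b q).trace) :
    s = 0 := by
  by_contra hs
  set H : Fin 3 → Matrix (Fin 3) (Fin 3) ℝ := fun i => Matrix.of fun j k => s * distinctSymbol i j k
    with hH
  set K : Fin 3 → Fin 3 → Fin 3 → Fin 3 → ℝ := fun i j k l =>
    dirDeriv (e l) (dirDeriv (e k) (fun q => U q i j)) p with hK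
  set N : Fin 3 → Fin 3 → Fin 3 → Fin 3 → Fin 3 → ℝ := fun i j k m l =>
    dirDeriv (e l) (dirDeriv (e m) (dirDeriv (e k) (fun q => U q i j))) p with hN
  have hU2 : ∀ i j k, ContDiffAt ℝ 2 (dirDeriv (e k) (fun q => U q i j)) p := fun i j k =>
    contDiffAt_dirDeriv (hU i j) (by norm_num) _
  have hUev : ∀ i j, ∀ᶠ q in 𝓝 p, ContDiffAt ℝ 2 (fun q => U q i j) q := fun i j =>
    ((hU i j).of_le (by norm_num)).eventually (by simp)
  -- `U` vanishes at `p`, so the metric and its adjugate agree with `1` to first order there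
  have jetU : ∀ l m i j, HasJet (e l) (e m) p (fun q => U q i j) 0 (H l i j) (H m i j)
      (K i j m l) := by
    intro l m i j
    refine (HasJet.of_contDiffAt ((hU i j).of_le (by norm_num))).cast (by simp [h0]) ?_ ?_ rfl
    · rw [hcubic]; simp [hH, distinctSymbol]; grind
    · rw [hcubic]; simp [hH, distinctSymbol]; grind
  have jetH : ∀ l m i j k, HasJet (e l) (e m) p (fun q => componentHessian e U i q j k) (H i j k)
      (K i j k l) (K i j k m) (N i j k m l) := fun l m i j k =>
    (HasJet.of_contDiffAt (hU2 i j k)).cast (hcubic i j k) rfl rfl rfl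
  let Z : Fin 3 → Fin 3 → Matrix (Fin 3) (Fin 3) ℝ := fun l m =>
    (H l).transpose * H m + (H m).transpose * H l
  have jetg : ∀ l m i j, HasJet (e l) (e m) p (fun q => graphMetric (U q) i j)
      ((1 : Matrix (Fin 3) (Fin 3) ℝ) i j) 0 0 (Z l m i j) := fun l m =>
    hasJet_graphMetric (z := Matrix.of fun i j => K i j m l) (jetU l m)
  let R : Fin 3 → Fin 3 → Fin 3 → Matrix (Fin 3) (Fin 3) ℝ := fun l m i =>
    ((Z l m).trace • (1 : Matrix (Fin 3) (Fin 3) ℝ) - Z l m) * H i + Matrix.of fun j k => N i j k m l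
  have jetS : ∀ l m i j k, HasJet (e l) (e m) p (fun q => shapeMatrix e U i q j k) (H i j k)
      (K i j k l) (K i j k m) (R l m i j k) := by
    intro l m i j k
    have := hasJet_matrix_mul (a₁ := 0) (a₂ := 0) (b₁ := Matrix.of fun j k => K i j k l)
      (b₂ := Matrix.of fun j k => K i j k m) (b₃ := Matrix.of fun j k => N i j k m l)
      (hasJet_adjugate (jetg l m)) (jetH l m i) j k
    refine this.cast ?_ ?_ ?_ ?_ <;> simp [R]
  have zero_jet : ∀ {v w : E} {φ : E → ℝ} {a b c d : ℝ}, HasJet v w p φ a b c d →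
      (∀ᶠ q in 𝓝 p, φ q = 0) → b = 0 ∧ d = 0 := by
    intro v w φ a b c d h e
    have h' := h.congr (ψ := fun _ => 0) e
    have h'' := HasJet.const (v := v) (w := w) (p := p) 0
    exact ⟨h'.fst.symm.trans h''.fst, h'.mixed.symm.trans h''.mixed⟩
  have trace_rel : ∀ l m i, (∑ j, K i j j l = 0) ∧ (R l m i).trace = 0 := by
    intro l m i
    exact zero_jet (hasJet_trace (a₁ := Matrix.of fun j k => K i j k l)
      (a₂ := Matrix.of fun j k => K i j k m) (jetS l m i)) (htr i)
  have quad_rel := fun l m i j a b => zero_jet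
    (((jetg l m a b).mul (hasJet_trace (hasJet_matrix_mul (a₁ := Matrix.of fun j k => K i j k l)
      (a₂ := Matrix.of fun j k => K i j k m) (b₁ := Matrix.of fun k r => K j k r l)
      (b₂ := Matrix.of fun k r => K j k r m) (jetS l m i) (jetS l m j)))).sub
      ((jetg l m i j).mul (hasJet_trace (hasJet_matrix_mul (a₁ := Matrix.of fun j k => K a j k l)
      (a₂ := Matrix.of fun j k => K a j k m) (b₁ := Matrix.of fun k r => K b k r l)
      (b₂ := Matrix.of fun k r => K b k r m) (jetS l m a) (jetS l m b)))))
      ((hquad i j a b).mono fun q hq => sub_eq_zero.2 hq)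
  have K12 : ∀ i j k l, K i j k l = K j i k l := fun i j k l =>
    (dirDeriv_eventuallyEq (dirDeriv_eventuallyEq (hsymm i j) _) _).eq_of_nhds
  have K23 : ∀ i j k l, K i j k l = K i k j l := fun i j k l =>
    (dirDeriv_eventuallyEq (hclosed i j k) _).eq_of_nhds
  have K34 : ∀ i j k l, K i j k l = K i j l k := fun i j k l =>
    dirDeriv_comm ((hU i j).of_le (by norm_num)) _ _
  have N12 : ∀ i j k l m, N i j k l m = N j i k l m := fun i j k l m =>
    (dirDeriv_eventuallyEq (dirDeriv_eventuallyEq (dirDeriv_eventuallyEq (hsymm i j) _) _)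
      _).eq_of_nhds
  have N23 : ∀ i j k l m, N i j k l m = N i k j l m := fun i j k l m =>
    (dirDeriv_eventuallyEq (dirDeriv_eventuallyEq (hclosed i j k) _) _).eq_of_nhds
  have N34 : ∀ i j k l m, N i j k l m = N i j l k m := fun i j k l m =>
    (dirDeriv_eventuallyEq ((hUev i j).mono fun q hq => dirDeriv_comm hq _ _) _).eq_of_nhds
  have N45 : ∀ i j k l m, N i j k l m = N i j k m l := fun i j k l m =>
    dirDeriv_comm (hU2 i j k) _ _
  -- first derivatives of the identities: the fourth derivatives of the potential vanish
  have K0 : ∀ i j k l, K i j k l = 0 := by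
    clear_value K N
    have q0 := fun l => (quad_rel l l 1 2 0 0).1
    have q1 := fun l => (quad_rel l l 0 2 0 0).1
    have q2 := fun l => (quad_rel l l 0 1 0 0).1
    simp [Matrix.trace, Fin.sum_univ_three, Matrix.mul_apply, hH, distinctSymbol] at q0 q1 q2
    refine quartic_eq_zero K12 K23 K34 (fun i l => ?_) (fun l => ?_) (fun l => ?_) (fun l => ?_)
    · simpa [Fin.sum_univ_three] using (trace_rel l l i).1
    · have h := q0 l
      rw [K23 1 0 1 l, K23 2 0 2 l] at h
      exact mul_left_cancel₀ (mul_ne_zero two_ne_zero hs) (by linarith)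
    · have h := q1 l
      rw [K23 0 1 0 l, K23 2 1 2 l] at h
      exact mul_left_cancel₀ (mul_ne_zero two_ne_zero hs) (by linarith)
    · have h := q2 l
      rw [K23 0 2 0 l, K23 1 2 1 l] at h
      exact mul_left_cancel₀ (mul_ne_zero two_ne_zero hs) (by linarith)
  clear_value K N
  obtain rfl : K = fun _ _ _ _ => 0 := by ext i j k l; exact K0 i j k l
  -- second derivatives of the identities, as equations between fifth derivatives
  have q0 := (quad_rel 1 2 1 2 0 0).2
  have q1 := (quad_rel 0 2 0 2 0 0).2
  have q2 := (quad_rel 0 1 0 1 0 0).2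
  have t0 := (trace_rel 1 2 0).2
  clear * - q0 q1 q2 t0 N12 N23 N34 N45 hs
  simp [Matrix.trace, Fin.sum_univ_three, Matrix.mul_apply, R, Z, H, distinctSymbol]
    at q0 q1 q2 t0
  simp only [N12, N23, N34, N45] at q0 q1 q2 t0
  refine hs (pow_eq_zero_iff (n := 4) (by norm_num) |>.1 ?_)
  linear_combination (-1 / 4) * (q0 + q1 + q2) + s * t0

end Prolongation

/-! ### Cubics invariant under commuting half-turns -/

section KleinFour

/-- A half-turn of a 3-space has trace `-1`, by the Cayley-Hamilton theorem. -/
theorem matrix_trace_eq_neg_one_of_mul_self_eq_one {S : Matrix (Fin 3) (Fin 3) ℝ} (hS : S * S = 1)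
    (hdet : S.det = 1) (hne : S ≠ 1) : S.trace = -1 := by
  have hadj : S.adjugate = S := by
    calc S.adjugate = S.adjugate * S * S := by rw [Matrix.mul_assoc, hS, Matrix.mul_one]
      _ = S := by rw [Matrix.adjugate_mul, hdet, one_smul, Matrix.one_mul]
  -- Cayley-Hamilton in dimension three, in the form `adj S = S² - (tr S) S + (tr adj S) 1`
  have hCH : S.adjugate = S * S - S.trace • S + S.adjugate.trace • (1 : Matrix _ _ ℝ) := by
    rw [Matrix.adjugate_fin_three]
    ext i j
    fin_cases i <;> fin_cases j <;>
      simp [Matrix.mul_apply, Fin.sum_univ_three, Matrix.trace] <;> ring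
  rw [hadj, hS] at hCH
  by_contra ht
  have ht' : 1 + S.trace ≠ 0 := fun h => ht (by linarith)
  have h : (1 + S.trace) • (S - 1) = 0 := by
    have : S + S.trace • S = 1 + S.trace • (1 : Matrix (Fin 3) (Fin 3) ℝ) := by
      nth_rewrite 1 [hCH]; abel
    rw [smul_sub, add_smul, add_smul, one_smul, one_smul, this, sub_self]
  exact hne (sub_eq_zero.1 ((smul_eq_zero.1 h).resolve_left ht'))

variable {V : Type*} [AddCommGroup V] [Module ℝ V]

theorem trace_eq_neg_one_of_mul_self_eq_one (hV : Module.finrank ℝ V = 3) {S : V →ₗ[ℝ] V}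
    (hS : S * S = 1) (hdet : LinearMap.det S = 1) (hne : S ≠ 1) : LinearMap.trace ℝ V S = -1 := by
  have : Module.Finite ℝ V := Module.finite_of_finrank_pos (by omega)
  let b := Module.finBasisOfFinrankEq ℝ V hV
  rw [LinearMap.trace_eq_matrix_trace ℝ b]
  refine matrix_trace_eq_neg_one_of_mul_self_eq_one ?_ ?_ fun h => hne ?_
  · rw [← LinearMap.toMatrix_mul, hS, LinearMap.toMatrix_one]
  · rw [LinearMap.det_toMatrix, hdet]
  · rw [← LinearMap.toMatrix_one b] at h
    exact (LinearMap.toMatrix b b).injective h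

/-- Two distinct commuting rotations of order two of a 3-space have a common eigenvector with
eigenvalues `1` and `-1`: the projection `(1 + S) (1 - T) / 4` onto the space of such vectors has
trace `1`. -/
theorem exists_fixed_anti (hV : Module.finrank ℝ V = 3) {S T : V →ₗ[ℝ] V} (hS : S * S = 1)
    (hT : T * T = 1) (hST : S * T = T * S) (hdS : LinearMap.det S = 1) (hdT : LinearMap.det T = 1)
    (hS1 : S ≠ 1) (hT1 : T ≠ 1) (hne : S ≠ T) : ∃ v, v ≠ 0 ∧ S v = v ∧ T v = -v := by
  have tS := trace_eq_neg_one_of_mul_self_eq_one hV hS hdS hS1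
  have tT := trace_eq_neg_one_of_mul_self_eq_one hV hT hdT hT1
  have tST : LinearMap.trace ℝ V (S * T) = -1 := by
    refine trace_eq_neg_one_of_mul_self_eq_one hV ?_ (by rw [map_mul, hdS, hdT, one_mul])
      fun h => hne ?_
    · rw [mul_assoc, ← mul_assoc T, ← hST, mul_assoc S T, hT, mul_one, hS]
    · calc S = S * (T * T) := by rw [hT, mul_one]
        _ = T := by rw [← mul_assoc, h, one_mul]
  have htr : LinearMap.trace ℝ V ((1 + S) * (1 - T)) = 4 := by
    have : Module.Finite ℝ V := Module.finite_of_finrank_pos (by omega)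
    have e : (1 + S) * (1 - T) = 1 + S - T - S * T := by noncomm_ring
    rw [e, map_sub, map_sub, map_add, tS, tT, tST, LinearMap.trace_one, hV]
    norm_num
  have hP : (1 + S) * (1 - T) ≠ 0 := fun h => by simp [h] at htr
  obtain ⟨v, hv⟩ := DFunLike.ne_iff.1 hP
  refine ⟨((1 + S) * (1 - T)) v, hv, ?_, ?_⟩
  · have : S * ((1 + S) * (1 - T)) = (1 + S) * (1 - T) := by
      rw [← mul_assoc, mul_add, hS, mul_one, add_comm]
    exact LinearMap.congr_fun this v
  · have : T * ((1 + S) * (1 - T)) = -((1 + S) * (1 - T)) := by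
      rw [← mul_assoc, mul_add, mul_one, ← hST, show T + S * T = (1 + S) * T by noncomm_ring,
        mul_assoc, mul_sub, hT, mul_one, ← mul_neg, neg_sub]
    exact LinearMap.congr_fun this v

theorem exists_commuting_involutions_alternatingGroup :
    ∃ σ τ : alternatingGroup (Fin 4), σ * σ = 1 ∧ τ * τ = 1 ∧ σ * τ = τ * σ ∧ σ ≠ 1 ∧ τ ≠ 1 ∧
      σ ≠ τ :=
  ⟨⟨Equiv.swap 0 1 * Equiv.swap 2 3,
      Equiv.Perm.mem_alternatingGroup.2 (by decide)⟩, 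
    ⟨Equiv.swap 0 2 * Equiv.swap 1 3, Equiv.Perm.mem_alternatingGroup.2 (by decide)⟩,
    by decide, by decide, by decide, by decide, by decide, by decide⟩

theorem trilinear_eq_polarization {c : V →ₗ[ℝ] V →ₗ[ℝ] V →ₗ[ℝ] ℝ}
    (h12 : ∀ x y z, c x y z = c y x z) (h23 : ∀ x y z, c x y z = c x z y) (x y z : V) :
    c x y z = (c (x + y + z) (x + y + z) (x + y + z)
      - c (x + y) (x + y) (x + y) - c (x + z) (x + z) (x + z) - c (y + z) (y + z) (y + z)
      + c x x x + c y y y + c z z z) / 6 := by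
  simp only [map_add, LinearMap.add_apply]
  linarith [h12 y x z, h23 x z y, h12 z x y, h23 y z x, h12 z y x]

theorem trilinear_invariant_of_cubic_invariant {c : V →ₗ[ℝ] V →ₗ[ℝ] V →ₗ[ℝ] ℝ}
    (h12 : ∀ x y z, c x y z = c y x z) (h23 : ∀ x y z, c x y z = c x z y) {A : V →ₗ[ℝ] V}
    (hA : ∀ x, c (A x) (A x) (A x) = c x x x) (x y z : V) : c (A x) (A y) (A z) = c x y z := by
  have h := trilinear_eq_polarization h12 h23 (A x) (A y) (A z)
  simp only [← map_add A, hA] at h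
  rw [h, ← trilinear_eq_polarization h12 h23]

/-- A cubic form on a Euclidean 3-space that is invariant under a group of rotations isomorphic to
`A₄` is a multiple of `x₀ x₁ x₂` in suitable orthonormal coordinates. Already the Klein four-group
in `A₄` forces this: its involutions are simultaneously diagonalizable with signs `(1, -1, -1)` and
permutations, and every monomial except `x₀ x₁ x₂` is odd under one of them. -/
theorem exists_orthonormal_frame_of_invariant (hV : Module.finrank ℝ V = 3)
    {g : V →ₗ[ℝ] V →ₗ[ℝ] ℝ} (gpos : ∀ x, x ≠ 0 → 0 < g x x)
    {c : V →ₗ[ℝ] V →ₗ[ℝ] V →ₗ[ℝ] ℝ}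
    (h12 : ∀ x y z, c x y z = c y x z) (h23 : ∀ x y z, c x y z = c x z y)
    {G : Subgroup (V ≃ₗ[ℝ] V)} (eG : G ≃* alternatingGroup (Fin 4))
    (hg : ∀ A ∈ G, ∀ x y, g (A x) (A y) = g x y) (hdet : ∀ A ∈ G, LinearEquiv.det A = 1)
    (hc : ∀ A ∈ G, ∀ x, c (A x) (A x) (A x) = c x x x) :
    ∃ (b : Fin 3 → V) (s : ℝ), (∀ i j, g (b i) (b j) = if i = j then 1 else 0) ∧
      ∀ i j k, c (b i) (b j) (b k) = s * distinctSymbol i j k := by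
  obtain ⟨σ, τ, hσ, hτ, hστ, hσ1, hτ1, hne⟩ := exists_commuting_involutions_alternatingGroup
  let ρ : alternatingGroup (Fin 4) → (V →ₗ[ℝ] V) := fun a => ((eG.symm a : V ≃ₗ[ℝ] V) : V →ₗ[ℝ] V)
  have ρmul : ∀ a a', ρ (a * a') = ρ a * ρ a' := by
    intro a a'; ext x; simp [ρ]
  have ρone : ρ 1 = 1 := by ext x; simp [ρ]
  have ρinj : Function.Injective ρ := by
    intro a a' h
    apply eG.symm.injective
    apply Subtype.ext
    exact LinearEquiv.toLinearMap_injective h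
  have ρdet : ∀ a, LinearMap.det (ρ a) = 1 := by
    intro a
    have := hdet _ (eG.symm a).2
    have := congrArg Units.val this
    simpa [ρ] using this
  have ρg : ∀ a x y, g (ρ a x) (ρ a y) = g x y := fun a => hg _ (eG.symm a).2
  have ρc : ∀ a x y z, c (ρ a x) (ρ a y) (ρ a z) = c x y z := fun a =>
    trilinear_invariant_of_cubic_invariant h12 h23 (hc _ (eG.symm a).2)
  have hS : ρ σ * ρ σ = 1 := by rw [← ρmul, hσ, ρone]
  have hT : ρ τ * ρ τ = 1 := by rw [← ρmul, hτ, ρone]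
  have hST : ρ σ * ρ τ = ρ τ * ρ σ := by rw [← ρmul, hστ, ρmul]
  have hS1 : ρ σ ≠ 1 := by rw [← ρone]; exact ρinj.ne hσ1
  have hT1 : ρ τ ≠ 1 := by rw [← ρone]; exact ρinj.ne hτ1
  have hne' : ρ σ ≠ ρ τ := ρinj.ne hne
  have gS := ρg σ
  have gT := ρg τ
  have cS := ρc σ
  have cT := ρc τ
  have dS := ρdet σ
  have dT := ρdet τ
  generalize ρ σ = S at *
  generalize ρ τ = T at *
  have hU1 : S * T ≠ 1 := fun h => hne' <| by
    calc S = S * (T * T) := by rw [hT, mul_one]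
      _ = T := by rw [← mul_assoc, h, one_mul]
  have hUS : S * T ≠ S := fun h => hT1 <| by
    calc T = (S * S) * T := by rw [hS, one_mul]
      _ = 1 := by rw [mul_assoc, h, hS]
  -- eigenvectors for the sign pairs `(1, -1)`, `(-1, 1)` and `(-1, -1)` of `(S, T)`; the third one is
  -- fixed by the third half-turn `S * T`
  obtain ⟨a₀, n₀, S₀, T₀⟩ := exists_fixed_anti hV hS hT hST dS dT hS1 hT1 hne'
  obtain ⟨a₁, n₁, T₁, S₁⟩ := exists_fixed_anti hV hT hS hST.symm dT dS hT1 hS1 hne'.symm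
  obtain ⟨a₂, n₂, U₂, S₂⟩ := exists_fixed_anti hV (S := S * T) (T := S)
    (by rw [mul_assoc, ← mul_assoc T, ← hST, mul_assoc S T, hT, mul_one, hS]) hS
    (by rw [mul_assoc, ← hST]) (by rw [map_mul, dS, dT, one_mul]) dS hU1 hS1 hUS
  have T₂ : T a₂ = -a₂ := by
    have h : (S * S) (T a₂) = S ((S * T) a₂) := rfl
    rwa [hS, U₂, S₂] at h
  let a : Fin 3 → V := ![a₀, a₁, a₂]
  let b : Fin 3 → V := fun i => (√(g (a i) (a i)))⁻¹ • a i
  have ha : ∀ i, a i ≠ 0 := by intro i; fin_cases i <;> assumption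
  have Sb : ∀ i, S (b i) = (![1, -1, -1] : Fin 3 → ℝ) i • b i := by
    intro i
    fin_cases i <;> simp [b, a, S₀, S₁, S₂]
  have Tb : ∀ i, T (b i) = (![-1, 1, -1] : Fin 3 → ℝ) i • b i := by
    intro i
    fin_cases i <;> simp [b, a, T₀, T₁, T₂]
  -- for `i ≠ j`, and for `i, j, k` not all distinct, `S` or `T` changes the sign of the value
  refine ⟨b, c (b 0) (b 1) (b 2), fun i j => ?_, fun i j k => ?_⟩
  · split_ifs with hij
    · subst hij
      have hpos := gpos _ (ha i)
      simp only [b, map_smul, LinearMap.smul_apply, smul_eq_mul]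
      rw [← mul_assoc, ← mul_inv, Real.mul_self_sqrt hpos.le, inv_mul_cancel₀ hpos.ne']
    · have e1 := gS (b i) (b j)
      have e2 := gT (b i) (b j)
      rw [Sb, Sb] at e1
      rw [Tb, Tb] at e2
      simp only [map_smul, LinearMap.smul_apply, smul_eq_mul] at e1 e2
      fin_cases i <;> fin_cases j <;> simp at hij e1 e2 ⊢ <;> linarith
  · have e1 := cS (b i) (b j) (b k)
    have e2 := cT (b i) (b j) (b k)
    rw [Sb, Sb, Sb] at e1
    rw [Tb, Tb, Tb] at e2
    simp only [map_smul, LinearMap.smul_apply, smul_eq_mul] at e1 e2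
    have r1 := h12 (b 1) (b 0) (b 2)
    have r2 := h23 (b 0) (b 2) (b 1)
    have r3 := h12 (b 2) (b 0) (b 1)
    have r4 := h23 (b 1) (b 2) (b 0)
    have r5 := h12 (b 2) (b 1) (b 0)
    clear_value b
    fin_cases i <;> fin_cases j <;> fin_cases k <;> simp [distinctSymbol] at e1 e2 ⊢ <;> linarith

end KleinFour

/-! ### Trace identities from orthonormal frames -/

section FrameIdentities

/-- If the cubic with coefficients `H i j k` is a multiple of `x₀ x₁ x₂` in a frame (the rows of
`A`) that is orthonormal for `g`, then the matrices `adj g * H i` are traceless and the traces of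
their products are proportional to `g`. -/
theorem trace_identities_of_frame {g A : Matrix (Fin 3) (Fin 3) ℝ}
    {H : Fin 3 → Matrix (Fin 3) (Fin 3) ℝ} {s : ℝ} (hg : g.transpose = g)
    (hA : A * g * A.transpose = 1)
    (hH : ∀ α β γ, ∑ i, A α i * (A * H i * A.transpose) β γ = s * distinctSymbol α β γ) :
    (∀ i, (g.adjugate * H i).trace = 0) ∧
      ∃ κ : ℝ, ∀ i j, ((g.adjugate * H i) * (g.adjugate * H j)).trace = κ * g i j := by
  have hA' : A.transpose * (A * g) = 1 := mul_eq_one_comm.1 hA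
  have hadj : g.adjugate = g.det • (A.transpose * A) := by
    calc g.adjugate = (A.transpose * (A * g)) * g.adjugate := by rw [hA', one_mul]
      _ = (A.transpose * A) * (g * g.adjugate) := by simp only [mul_assoc]
      _ = _ := by rw [Matrix.mul_adjugate, Matrix.mul_smul, mul_one]
  -- `A * H i * Aᵀ` is the `i`-th matrix of coefficients in the frame; the columns of `A * g` express
  -- the coordinate vectors in the frame
  let D : Fin 3 → Matrix (Fin 3) (Fin 3) ℝ := fun α => Matrix.of fun β γ => distinctSymbol α β γ
  have hexp : ∀ i, A * H i * A.transpose = s • ∑ α, (A * g) α i • D α := by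
    intro i
    ext β γ
    have h1 : ∀ k, ∑ α, (A * g) α i * A α k = if k = i then 1 else 0 := by
      intro k
      have := congrFun (congrFun hA' k) i
      rw [Matrix.mul_apply, Matrix.one_apply] at this
      rw [← this]
      exact Finset.sum_congr rfl fun α _ => by rw [Matrix.transpose_apply, mul_comm]
    calc (A * H i * A.transpose) β γ
        = ∑ k, (∑ α, (A * g) α i * A α k) * (A * H k * A.transpose) β γ := by simp [h1]
      _ = ∑ α, (A * g) α i * ∑ k, A α k * (A * H k * A.transpose) β γ := by
          simp only [Finset.sum_mul, Finset.mul_sum]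
          rw [Finset.sum_comm]
          simp only [mul_assoc]
      _ = _ := by
          simp only [hH, D, Matrix.smul_apply, Matrix.sum_apply, Matrix.of_apply, smul_eq_mul,
            Finset.mul_sum]
          exact Finset.sum_congr rfl fun α _ => by ring
  have hDtr : ∀ α, (D α).trace = 0 := by
    intro α; fin_cases α <;> simp [D, Matrix.trace, distinctSymbol]
  have hDD : ∀ α β, (D α * D β).trace = if α = β then 2 else 0 := by
    intro α β
    fin_cases α <;> fin_cases β <;>
      simp [D, Matrix.trace, Fin.sum_univ_three, distinctSymbol, Matrix.mul_apply] <;> norm_num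
  refine ⟨fun i => ?_, 2 * g.det ^ 2 * s ^ 2, fun i j => ?_⟩
  · rw [hadj, Matrix.smul_mul, Matrix.trace_smul, mul_assoc, Matrix.trace_mul_comm, hexp]
    simp [Matrix.trace_sum, hDtr]
  · have e : (g.adjugate * H i) * (g.adjugate * H j) =
        g.det ^ 2 • (A.transpose * ((A * H i * A.transpose) * (A * H j))) := by
      rw [hadj]
      simp only [Matrix.smul_mul, Matrix.mul_smul, smul_smul, mul_assoc, pow_two]
    have hBB : ∑ α, (A * g) α i * (A * g) α j = g i j := by
      have : (A * g).transpose * (A * g) = g := by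
        rw [Matrix.transpose_mul, hg, mul_assoc, hA', mul_one]
      conv_rhs => rw [← this]
      rfl
    rw [e, Matrix.trace_smul, Matrix.trace_mul_comm, mul_assoc (A * H i * A.transpose), hexp, hexp,
      ← hBB]
    simp only [Matrix.smul_mul, Matrix.mul_smul, Finset.sum_mul, Finset.mul_sum, Matrix.trace_sum,
      Matrix.trace_smul, smul_eq_mul, hDD, mul_ite, mul_zero, Finset.sum_ite_eq', Finset.mem_univ,
      if_true]
    exact Finset.sum_congr rfl fun α _ => by ring

end FrameIdentities

section GraphCubic

variable {E : Type*} [NormedAddCommGroup E] [NormedSpace ℝ E]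

/-- The Jacobian matrix of the map with components `G i`, in the directions `e j`. -/
noncomputable def jacobian (e : Fin 3 → E) (G : Fin 3 → E → ℝ) (q : E) :
    Matrix (Fin 3) (Fin 3) ℝ :=
  Matrix.of fun i j => dirDeriv (e j) (G i) q

/-- For a gradient graph, tangent to the horizontal plane at `p`, whose cubic is a multiple of
`x₀ x₁ x₂` in an orthonormal frame (the rows of `A`) at each point near `p`, the cubic vanishes
at `p`. The frame at `p` itself is taken to be the standard one. -/
theorem componentHessian_eq_zero_of_frames {e : Fin 3 → E} {G : Fin 3 → E → ℝ} {p : E}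
    (hG : ∀ i, ContDiffAt ℝ 4 (G i) p)
    (hsymm : ∀ᶠ q in 𝓝 p, (jacobian e G q).transpose = jacobian e G q)
    (h0 : jacobian e G p = 0)
    (hcubic : ∃ s, ∀ i j k, componentHessian e (jacobian e G) i p j k = s * distinctSymbol i j k)
    (hframe : ∀ᶠ q in 𝓝 p, ∃ (A : Matrix (Fin 3) (Fin 3) ℝ) (s : ℝ),
      A * graphMetric (jacobian e G q) * A.transpose = 1 ∧
      ∀ α β γ, ∑ i, A α i * (A * componentHessian e (jacobian e G) i q * A.transpose) β γ =
        s * distinctSymbol α β γ) (i : Fin 3) :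
    componentHessian e (jacobian e G) i p = 0 := by
  obtain ⟨s, hs⟩ := hcubic
  have hid : ∀ᶠ q in 𝓝 p, (∀ i, (shapeMatrix e (jacobian e G) i q).trace = 0) ∧ ∃ κ : ℝ, ∀ i j,
      (shapeMatrix e (jacobian e G) i q * shapeMatrix e (jacobian e G) j q).trace =
        κ * graphMetric (jacobian e G q) i j := by
    filter_upwards [hframe] with q ⟨A, s, hA, hH⟩
    exact trace_identities_of_frame (by simp [graphMetric]) hA hH
  have hz : s = 0 := by
    refine cubic_coefficient_eq_zero (e := e) (U := jacobian e G) (p := p)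
      (fun i j => contDiffAt_dirDeriv (hG i) (by norm_num) _)
      (fun i j => hsymm.mono fun q hq => congrFun (congrFun hq j) i) (fun i j k => ?_) h0 hs
      (fun i => hid.mono fun q hq => hq.1 i) (fun i j a b => hid.mono fun q hq => ?_)
    · filter_upwards [(hG i).eventually (by simp)] with q hq
      exact dirDeriv_comm (hq.of_le (by norm_num)) _ _
    · obtain ⟨κ, hκ⟩ := hq.2
      rw [hκ, hκ]; ring
  ext j k
  rw [hs, hz, zero_mul, Matrix.zero_apply]

end GraphCubic

/-! ### Unitary coordinates and charts -/

section Coordinates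

theorem inner_real_eq_re (z w : CThree) : inner ℝ z w = (inner ℂ z w : ℂ).re := by
  simp [PiLp.inner_apply, Complex.inner, Complex.re_sum]

theorem kahlerForm_eq_im_inner (z w : CThree) : kahlerForm z w = (inner ℂ z w : ℂ).im := by
  simp only [kahlerForm, PiLp.inner_apply, Complex.im_sum]
  refine Finset.sum_congr rfl fun j _ => ?_
  simp
  ring

theorem inner_complexStructure (z w : CThree) :
    inner ℝ z (complexStructure w) = -kahlerForm z w := by
  rw [inner_real_eq_re, complexStructure, inner_smul_right, kahlerForm_eq_im_inner]
  simp

variable (e : OrthonormalBasis (Fin 3) ℂ CThree)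

/-- The real parts of the coordinates of a vector in the unitary basis `e`. -/
noncomputable def horizontal : CThree →L[ℝ] RThree :=
  LinearMap.toContinuousLinearMap
    { toFun := fun z => WithLp.toLp 2 fun i => (e.repr z i).re
      map_add' := fun z w => by ext i; simp
      map_smul' := fun r z => by
        ext i
        change (e.repr (r • z) i).re = r * (e.repr z i).re
        rw [← Complex.coe_smul, map_smul]
        simp }

/-- The imaginary part of the `i`-th coordinate of a vector in the unitary basis `e`. -/
noncomputable def vertical (i : Fin 3) : CThree →L[ℝ] ℝ :=
  LinearMap.toContinuousLinearMap
    { toFun := fun z => (e.repr z i).im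
      map_add' := fun z w => by simp
      map_smul' := fun r z => by
        change (e.repr (r • z) i).im = r * (e.repr z i).im
        rw [← Complex.coe_smul, map_smul]
        simp }

@[simp] theorem horizontal_apply (z : CThree) (i : Fin 3) :
    horizontal e z i = (e.repr z i).re := rfl

@[simp] theorem vertical_apply (z : CThree) (i : Fin 3) : vertical e i z = (e.repr z i).im := rfl

theorem ext_horizontal_vertical {z w : CThree} (h : horizontal e z = horizontal e w)
    (h' : ∀ i, vertical e i z = vertical e i w) : z = w := by
  apply e.repr.injective
  ext i
  exact Complex.ext (congrArg (fun v : RThree => v i) h) (h' i)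

theorem inner_eq_horizontal_vertical (z w : CThree) : inner ℝ z w =
    ∑ i, (horizontal e z i * horizontal e w i + vertical e i z * vertical e i w) := by
  rw [inner_real_eq_re, ← e.repr.inner_map_map, PiLp.inner_apply, Complex.re_sum]
  refine Finset.sum_congr rfl fun j _ => ?_
  simp
  ring

theorem kahlerForm_eq_horizontal_vertical (z w : CThree) : kahlerForm z w =
    ∑ i, (horizontal e z i * vertical e i w - vertical e i z * horizontal e w i) := by
  rw [kahlerForm_eq_im_inner, ← e.repr.inner_map_map, PiLp.inner_apply, Complex.im_sum]
  refine Finset.sum_congr rfl fun j _ => ?_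
  simp
  ring

/-- A real orthonormal basis of a Lagrangian subspace is a unitary basis of complex 3-space. -/
theorem exists_unitary_basis {V : Submodule ℝ CThree}
    (hV : ∀ v ∈ V, ∀ w ∈ V, kahlerForm v w = 0) {v : Fin 3 → CThree} (hv : ∀ i, v i ∈ V)
    (horth : ∀ i j, inner ℝ (v i) (v j) = if i = j then (1 : ℝ) else 0) :
    ∃ e : OrthonormalBasis (Fin 3) ℂ CThree, (∀ i, e i = v i) ∧
      ∀ w ∈ V, ∀ i, vertical e i w = 0 := by
  have ho : Orthonormal ℂ v := by
    rw [orthonormal_iff_ite]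
    intro i j
    have h1 := horth i j
    have h2 := hV _ (hv i) _ (hv j)
    rw [inner_real_eq_re] at h1
    rw [kahlerForm_eq_im_inner] at h2
    apply Complex.ext
    · rw [h1]; split_ifs <;> simp
    · rw [h2]; split_ifs <;> simp
  have hcard : Fintype.card (Fin 3) = Module.finrank ℂ CThree := by simp
  let e : OrthonormalBasis (Fin 3) ℂ CThree :=
    (basisOfOrthonormalOfCardEqFinrank ho hcard).toOrthonormalBasis (by simpa using ho)
  have he' : ∀ i, e i = v i := fun i => by simp [e]
  refine ⟨e, he', fun w hw i => ?_⟩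
  rw [vertical_apply, e.repr_apply_apply, he', ← kahlerForm_eq_im_inner]
  exact hV _ (hv i) _ hw

end Coordinates

variable {M : Type*} [TopologicalSpace M] [ChartedSpace RThree M]
  {f : M → CThree}

/-- The map `f` read in the preferred chart at `x`. -/
noncomputable def inChart (f : M → CThree) (x : M) : RThree → CThree := f ∘ (extChartAt (𝓡 3) x).symm

theorem contDiffAt_inChart [IsManifold (𝓡 3) ∞ M] (hf : ContMDiff (𝓡 3) 𝓘(ℝ, CThree) ∞ f) (x : M) :
    ContDiffAt ℝ ∞ (inChart f x) (extChartAt (𝓡 3) x x) := by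
  have h : ContMDiffAt 𝓘(ℝ, RThree) (𝓡 3) ∞ (extChartAt (𝓡 3) x).symm (extChartAt (𝓡 3) x x) :=
    (contMDiffOn_extChartAt_symm x).contMDiffAt (extChartAt_target_mem_nhds x)
  exact ((hf _).comp _ h).contDiffAt

theorem differential_eq_fderiv (hf : ContMDiff (𝓡 3) 𝓘(ℝ, CThree) ∞ f) (x : M) :
    differential f x = fderiv ℝ (inChart f x) (extChartAt (𝓡 3) x x) := by
  have h : MDifferentiableAt (𝓡 3) 𝓘(ℝ, CThree) f x := (hf x).mdifferentiableAt (by simp)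
  have e : writtenInExtChartAt (𝓡 3) 𝓘(ℝ, CThree) x f = inChart f x := by
    rfl
  refine h.mfderiv.trans ?_
  rw [e, ModelWithCorners.range_eq_univ, fderivWithin_univ]

theorem inChart_self (x : M) : inChart f x (extChartAt (𝓡 3) x x) = f x := by
  simp [inChart]

/-! ### Local graphs over the tangent plane -/

section LocalGraph

variable {M : Type*} [TopologicalSpace M] [ChartedSpace RThree M] [IsManifold (𝓡 3) ∞ M]
  {f : M → CThree}

/-- Over its tangent plane at `x`, the immersed submanifold is locally a graph: projecting to the
horizontal coordinates of a unitary basis adapted to the tangent plane is invertible near `x`, with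
inverse `η`. -/
theorem exists_local_graph (hf : IsSpecialLagrangianImmersion f) (x : M)
    {e : OrthonormalBasis (Fin 3) ℂ CThree}
    (he : ∀ w ∈ tangentPlane f x, ∀ i, vertical e i w = 0) :
    ∃ η : RThree → M, Tendsto η (𝓝 (horizontal e (f x))) (𝓝 x) ∧
      ContDiffAt ℝ 4 (f ∘ η) (horizontal e (f x)) ∧
      (∀ᶠ q in 𝓝 (horizontal e (f x)), horizontal e (f (η q)) = q) ∧
      ∀ᶠ y in 𝓝 x, f (η (horizontal e (f y))) = f y := by
  set c := extChartAt (𝓡 3) x x with hc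
  have hF : ContDiffAt ℝ 4 (inChart f x) c :=
    mod_cast contDiffAt_infty.1 (contDiffAt_inChart hf.smooth x) 4
  have hP : ContDiffAt ℝ 4 (horizontal e ∘ inChart f x) c :=
    (horizontal e).contDiff.contDiffAt.comp c hF
  set D := fderiv ℝ (inChart f x) c with hD
  have hFD : HasFDerivAt (inChart f x) D c := (hF.differentiableAt (by norm_num)).hasFDerivAt
  have hDeq : differential f x = D := differential_eq_fderiv hf.smooth x
  have hinj : Function.Injective ((horizontal e).comp D) := by
    rw [injective_iff_map_eq_zero]
    intro v hv
    have h0 : D v = 0 := by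
      refine ext_horizontal_vertical e (by simpa using hv) fun i => ?_
      rw [map_zero]
      exact he _ ⟨v, congrArg (fun T : RThree →L[ℝ] CThree => T v) hDeq⟩ i
    exact hf.immersive x ((congrArg (fun T : RThree →L[ℝ] CThree => T v) hDeq).trans
      (h0.trans (map_zero (differential f x)).symm))
  let L : RThree ≃L[ℝ] RThree :=
    (LinearEquiv.ofInjectiveEndo ((horizontal e).comp D).toLinearMap hinj).toContinuousLinearEquiv
  have hPD : HasFDerivAt (horizontal e ∘ inChart f x) (L : RThree →L[ℝ] RThree) c := by
    have hL : (L : RThree →L[ℝ] RThree) = (horizontal e).comp D := by ext1 v; rfl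
    rw [hL]
    exact (horizontal e).hasFDerivAt.comp c hFD
  have hstrict := hP.hasStrictFDerivAt' hPD (by norm_num)
  let Θ := hstrict.localInverse (horizontal e ∘ inChart f x) L c
  have hfx : (horizontal e ∘ inChart f x) c = horizontal e (f x) :=
    congrArg (horizontal e) (inChart_self x)
  have hΘ : ContDiffAt ℝ 4 Θ (horizontal e (f x)) := by
    rw [← hfx]; exact hP.to_localInverse hPD (by norm_num)
  have hΘc : Θ (horizontal e (f x)) = c := by
    rw [← hfx]; exact hstrict.localInverse_apply_image
  have hΘt : Tendsto Θ (𝓝 (horizontal e (f x))) (𝓝 c) := by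
    have := hΘ.continuousAt.tendsto
    rwa [hΘc] at this
  refine ⟨(extChartAt (𝓡 3) x).symm ∘ Θ, ?_, ?_, ?_, ?_⟩
  · have := (continuousAt_extChartAt_symm (I := 𝓡 3) x).tendsto
    rw [extChartAt_to_inv] at this
    exact this.comp hΘt
  · have : ContDiffAt ℝ 4 (inChart f x ∘ Θ) (horizontal e (f x)) :=
      ContDiffAt.comp _ (by rwa [hΘc]) hΘ
    exact this
  · have := hstrict.eventually_right_inverse
    rw [hfx] at this
    exact this
  · have h1 := (continuousAt_extChartAt (I := 𝓡 3) x).eventually hstrict.eventually_left_inverse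
    filter_upwards [h1, extChartAt_source_mem_nhds (I := 𝓡 3) x] with y hy hys
    have e1 : inChart f x (extChartAt (𝓡 3) x y) = f y := by
      simp only [inChart, Function.comp_apply]
      rw [(extChartAt (𝓡 3) x).left_inv hys]
    have e2 : Θ (horizontal e (f y)) = extChartAt (𝓡 3) x y := by
      rw [← e1]; exact hy
    change f ((extChartAt (𝓡 3) x).symm (Θ (horizontal e (f y)))) = f y
    rw [e2, (extChartAt (𝓡 3) x).left_inv hys]

end LocalGraph

/-! ### Calculus of a Lagrangian graph -/

section GraphCalculus

/-- The standard basis of the model space. -/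
noncomputable def stdVec (j : Fin 3) : RThree := EuclideanSpace.single j 1

theorem sum_smul_stdVec (v : RThree) : ∑ j, v j • stdVec j = v := by
  ext i
  simp [stdVec, Fin.sum_univ_three]
  fin_cases i <;> simp

/-- The vertical components, in the unitary basis `e`, of a map into complex 3-space. -/
noncomputable def verticalPart (e : OrthonormalBasis (Fin 3) ℂ CThree) (Φ : RThree → CThree) (i : Fin 3)
    (q : RThree) : ℝ := vertical e i (Φ q)

variable {e : OrthonormalBasis (Fin 3) ℂ CThree} {Φ : RThree → CThree} {q : RThree}

theorem fderiv_verticalPart (hΦ : DifferentiableAt ℝ Φ q) (i : Fin 3) :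
    fderiv ℝ (verticalPart e Φ i) q = (vertical e i).comp (fderiv ℝ Φ q) :=
  ((vertical e i).hasFDerivAt.comp q hΦ.hasFDerivAt).fderiv

theorem horizontal_fderiv (hΦ : DifferentiableAt ℝ Φ q)
    (hproj : ∀ᶠ q' in 𝓝 q, horizontal e (Φ q') = q') (v : RThree) :
    horizontal e (fderiv ℝ Φ q v) = v := by
  have h1 : HasFDerivAt (horizontal e ∘ Φ) ((horizontal e).comp (fderiv ℝ Φ q)) q :=
    (horizontal e).hasFDerivAt.comp q hΦ.hasFDerivAt
  have h2 : HasFDerivAt (horizontal e ∘ Φ) (ContinuousLinearMap.id ℝ RThree) q :=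
    (hasFDerivAt_id q).congr_of_eventuallyEq hproj
  exact congrArg (fun T : RThree →L[ℝ] RThree => T v) (h1.unique h2)

theorem vertical_fderiv (hΦ : DifferentiableAt ℝ Φ q) (i : Fin 3) (v : RThree) :
    vertical e i (fderiv ℝ Φ q v) =
      (jacobian stdVec (verticalPart e Φ) q).mulVec (WithLp.ofLp v) i := by
  conv_lhs => rw [← sum_smul_stdVec v]
  simp only [map_sum, map_smul, Matrix.mulVec, dotProduct, jacobian, dirDeriv, Matrix.of_apply,
    fderiv_verticalPart hΦ, smul_eq_mul, ContinuousLinearMap.comp_apply]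
  exact Finset.sum_congr rfl fun j _ => mul_comm _ _

/-- The induced metric of a graph. -/
theorem inner_fderiv (hΦ : DifferentiableAt ℝ Φ q)
    (hproj : ∀ᶠ q' in 𝓝 q, horizontal e (Φ q') = q') (v w : RThree) :
    inner ℝ (fderiv ℝ Φ q v) (fderiv ℝ Φ q w) =
      WithLp.ofLp v ⬝ᵥ (graphMetric (jacobian stdVec (verticalPart e Φ) q)).mulVec
        (WithLp.ofLp w) := by
  rw [inner_eq_horizontal_vertical e, Finset.sum_add_distrib]
  simp only [horizontal_fderiv hΦ hproj, vertical_fderiv hΦ]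
  rw [graphMetric, Matrix.add_mulVec, Matrix.one_mulVec, dotProduct_add, ← Matrix.mulVec_mulVec,
    Matrix.dotProduct_mulVec, Matrix.vecMul_transpose]
  rfl

theorem kahlerForm_fderiv (hΦ : DifferentiableAt ℝ Φ q)
    (hproj : ∀ᶠ q' in 𝓝 q, horizontal e (Φ q') = q') (z : CThree) (w : RThree)
    (hz : horizontal e z = 0) :
    kahlerForm z (fderiv ℝ Φ q w) = -∑ i, vertical e i z * w i := by
  rw [kahlerForm_eq_horizontal_vertical e]
  simp only [horizontal_fderiv hΦ hproj, hz]
  simp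

/-- The graph of a map is Lagrangian exactly where the Jacobian is symmetric. -/
theorem jacobian_symm (hΦ : DifferentiableAt ℝ Φ q)
    (hproj : ∀ᶠ q' in 𝓝 q, horizontal e (Φ q') = q')
    (hlag : ∀ v w, kahlerForm (fderiv ℝ Φ q v) (fderiv ℝ Φ q w) = 0) :
    (jacobian stdVec (verticalPart e Φ) q).transpose = jacobian stdVec (verticalPart e Φ) q := by
  ext i j
  have h := hlag (stdVec i) (stdVec j)
  rw [kahlerForm_eq_horizontal_vertical e] at h
  simp only [horizontal_fderiv hΦ hproj, vertical_fderiv hΦ] at h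
  simp [stdVec, Finset.sum_sub_distrib] at h
  rw [Matrix.transpose_apply]
  linarith [sub_eq_zero.1 h]

theorem horizontal_fderiv_fderiv (hΦ : ContDiffAt ℝ 2 Φ q)
    (hproj : ∀ᶠ q' in 𝓝 q, horizontal e (Φ q') = q') (v w : RThree) :
    horizontal e (fderiv ℝ (fderiv ℝ Φ) q v w) = 0 := by
  have hd : DifferentiableAt ℝ (fderiv ℝ Φ) q :=
    (hΦ.fderiv_right (m := 1) (by norm_num)).differentiableAt (by norm_num)
  have h1 : HasFDerivAt (fun q' => horizontal e (fderiv ℝ Φ q' w))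
      ((horizontal e).comp ((ContinuousLinearMap.apply ℝ CThree w).comp
        (fderiv ℝ (fderiv ℝ Φ) q))) q :=
    (horizontal e).hasFDerivAt.comp q
      ((ContinuousLinearMap.apply ℝ CThree w).hasFDerivAt.comp q hd.hasFDerivAt)
  have h2 : HasFDerivAt (fun q' => horizontal e (fderiv ℝ Φ q' w)) (0 : RThree →L[ℝ] RThree) q := by
    refine (hasFDerivAt_const w q).congr_of_eventuallyEq ?_
    filter_upwards [hproj.eventually_nhds, hΦ.eventually (by simp)] with q' hq' hΦ'
    exact horizontal_fderiv (hΦ'.differentiableAt (by norm_num)) hq' w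
  exact congrArg (fun T : RThree →L[ℝ] RThree => T v) (h1.unique h2)

theorem vertical_fderiv_fderiv (hΦ : ContDiffAt ℝ 2 Φ q) (i : Fin 3) (v w : RThree) :
    vertical e i (fderiv ℝ (fderiv ℝ Φ) q v w) = WithLp.ofLp w ⬝ᵥ
      (componentHessian stdVec (jacobian stdVec (verticalPart e Φ)) i q).mulVec
        (WithLp.ofLp v) := by
  have hd : DifferentiableAt ℝ (fderiv ℝ Φ) q :=
    (hΦ.fderiv_right (m := 1) (by norm_num)).differentiableAt (by norm_num)
  have key : ∀ j k, componentHessian stdVec (jacobian stdVec (verticalPart e Φ)) i q j k =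
      vertical e i (fderiv ℝ (fderiv ℝ Φ) q (stdVec k) (stdVec j)) := by
    intro j k
    have h1 : HasFDerivAt (fun q' => vertical e i (fderiv ℝ Φ q' (stdVec j)))
        ((vertical e i).comp ((ContinuousLinearMap.apply ℝ CThree (stdVec j)).comp
          (fderiv ℝ (fderiv ℝ Φ) q))) q :=
      (vertical e i).hasFDerivAt.comp q
        ((ContinuousLinearMap.apply ℝ CThree (stdVec j)).hasFDerivAt.comp q hd.hasFDerivAt)
    have h2 : (fun r => jacobian stdVec (verticalPart e Φ) r i j) =ᶠ[𝓝 q]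
        fun q' => vertical e i (fderiv ℝ Φ q' (stdVec j)) := by
      filter_upwards [hΦ.eventually (by simp)] with q' hΦ'
      simp [jacobian, dirDeriv, fderiv_verticalPart (hΦ'.differentiableAt (by norm_num))]
    have h3 := (h1.congr_of_eventuallyEq h2).fderiv
    simp only [componentHessian, Matrix.of_apply, dirDeriv]
    rw [h3]
    rfl
  conv_lhs => rw [← sum_smul_stdVec v, ← sum_smul_stdVec w]
  simp only [map_sum, map_smul, Matrix.mulVec, dotProduct, key, smul_eq_mul,
    sum_apply, smul_apply, Finset.mul_sum]
  exact Finset.sum_congr rfl fun j _ => Finset.sum_congr rfl fun k _ => by ring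

end GraphCalculus

/-! ### The fundamental cubic of a graph -/

section CubicOfGraph

variable {M : Type*} [TopologicalSpace M] [ChartedSpace RThree M] [IsManifold (𝓡 3) ∞ M]
  {f : M → CThree} {e : OrthonormalBasis (Fin 3) ℂ CThree} {Φ : RThree → CThree}

/-- The normal projection in the definition of the fundamental cubic can be dropped, because `J w`
is normal to a Lagrangian subspace containing `w`. -/
theorem inner_starProjection_complexStructure {V : Submodule ℝ CThree}
    (hV : ∀ v ∈ V, ∀ w ∈ V, kahlerForm v w = 0) (z : CThree) {w : CThree} (hw : w ∈ V) :
    inner ℝ (Vᗮ.starProjection z) (complexStructure w) = -kahlerForm z w := by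
  have hn : complexStructure w ∈ Vᗮ := by
    rw [Submodule.mem_orthogonal]
    intro u hu
    rw [inner_complexStructure, hV u hu w hw, neg_zero]
  rw [Submodule.inner_starProjection_left_eq_right, Submodule.starProjection_eq_self_iff.2 hn,
    inner_complexStructure]

theorem fderiv_fderiv_comp {E F G : Type*} [NormedAddCommGroup E] [NormedSpace ℝ E]
    [NormedAddCommGroup F] [NormedSpace ℝ F] [NormedAddCommGroup G] [NormedSpace ℝ G]
    {Ψ : F → G} {P : E → F} {c : E} (hΨ : ContDiffAt ℝ 2 Ψ (P c)) (hP : ContDiffAt ℝ 2 P c)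
    (a b : E) :
    fderiv ℝ (fderiv ℝ fun c' => Ψ (P c')) c a b =
      fderiv ℝ (fderiv ℝ Ψ) (P c) (fderiv ℝ P c a) (fderiv ℝ P c b) +
        fderiv ℝ Ψ (P c) (fderiv ℝ (fderiv ℝ P) c a b) := by
  have hΨ2 : DifferentiableAt ℝ (fderiv ℝ Ψ) (P c) :=
    (hΨ.fderiv_right (m := 1) (by norm_num)).differentiableAt (by norm_num)
  have hP2 : DifferentiableAt ℝ (fderiv ℝ P) c :=
    (hP.fderiv_right (m := 1) (by norm_num)).differentiableAt (by norm_num)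
  have hD : fderiv ℝ (fun c' => Ψ (P c')) =ᶠ[𝓝 c]
      fun c' => (fderiv ℝ Ψ (P c')).comp (fderiv ℝ P c') := by
    filter_upwards [hP.continuousAt.tendsto.eventually (hΨ.eventually (by simp)),
      hP.eventually (by simp)] with c' h2 h3
    exact fderiv_comp c' (h2.differentiableAt (by norm_num)) (h3.differentiableAt (by norm_num))
  have h1 : HasFDerivAt (fun c' => fderiv ℝ Ψ (P c')) ((fderiv ℝ (fderiv ℝ Ψ) (P c)).comp
      (fderiv ℝ P c)) c :=
    HasFDerivAt.comp c hΨ2.hasFDerivAt (hP.differentiableAt (by norm_num)).hasFDerivAt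
  rw [hD.fderiv_eq, (h1.clm_comp hP2.hasFDerivAt).fderiv]
  exact add_comm _ _

/-- Where the immersion is the graph `Φ` over the horizontal coordinates, the differential is that
of `Φ`, and the fundamental cubic is given by the second derivatives of the vertical components,
both up to the linear isomorphism `L` between the tangent space and the horizontal space. -/
theorem exists_linearEquiv_fundamentalCubic (hf : IsSpecialLagrangianImmersion f) {y : M}
    {q : RThree} (hy : horizontal e (f y) = q) (hΦ : ContDiffAt ℝ 2 Φ q)
    (hproj : ∀ᶠ q' in 𝓝 q, horizontal e (Φ q') = q')
    (hloc : ∀ᶠ y' in 𝓝 y, Φ (horizontal e (f y')) = f y') :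
    (jacobian stdVec (verticalPart e Φ) q).transpose = jacobian stdVec (verticalPart e Φ) q ∧
    ∃ L : TangentSpace (𝓡 3) y ≃ₗ[ℝ] RThree,
      (∀ a, differential f y a = fderiv ℝ Φ q (L a)) ∧
      ∀ a, fundamentalCubic f y a = ∑ i, L a i * (WithLp.ofLp (L a) ⬝ᵥ
        (componentHessian stdVec (jacobian stdVec (verticalPart e Φ)) i q).mulVec
          (WithLp.ofLp (L a))) := by
  set c := extChartAt (𝓡 3) y y with hc
  set F := inChart f y with hFdef
  have hF : ContDiffAt ℝ 4 F c := mod_cast contDiffAt_infty.1 (contDiffAt_inChart hf.smooth y) 4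
  have hFc : F c = f y := inChart_self y
  have hDeq : ∀ a : RThree, differential f y a = fderiv ℝ F c a := fun a =>
    congrArg (fun T : RThree →L[ℝ] CThree => T a) (differential_eq_fderiv hf.smooth y)
  let P : RThree → RThree := fun c' => horizontal e (F c')
  have hP : ContDiffAt ℝ 4 P c := (horizontal e).contDiff.contDiffAt.comp c hF
  have hPc : P c = q := by simp only [P, hFc, hy]
  have hcomp : F =ᶠ[𝓝 c] fun c' => Φ (P c') := by
    have ht := (continuousAt_extChartAt_symm (I := 𝓡 3) y).tendsto
    rw [extChartAt_to_inv] at ht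
    filter_upwards [ht.eventually hloc] with c' hc'
    exact hc'.symm
  have hΦ1 : DifferentiableAt ℝ Φ q := hΦ.differentiableAt (by norm_num)
  have hΦ' : ContDiffAt ℝ 2 Φ (P c) := by rwa [hPc]
  have hP' : ContDiffAt ℝ 2 P c := hP.of_le (by norm_num)
  have hDFc : ∀ a, fderiv ℝ F c a = fderiv ℝ Φ q (fderiv ℝ P c a) := by
    intro a
    rw [hcomp.fderiv_eq, fderiv_fun_comp c (hΦ'.differentiableAt (by norm_num))
      (hP'.differentiableAt (by norm_num)), hPc]
    rfl
  have hinj : Function.Injective (fderiv ℝ P c) := by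
    rw [injective_iff_map_eq_zero]
    intro v hv
    have h0 : fderiv ℝ F c v = 0 := by rw [hDFc, hv, map_zero]
    exact hf.immersive y ((hDeq v).trans (h0.trans (map_zero (differential f y)).symm))
  let L : RThree ≃ₗ[ℝ] RThree := LinearEquiv.ofInjectiveEndo (fderiv ℝ P c).toLinearMap hinj
  have hL : ∀ a, L a = fderiv ℝ P c a := fun a => rfl
  have hmem : ∀ v, fderiv ℝ Φ q v ∈ tangentPlane f y := by
    intro v
    refine ⟨L.symm v, (hDeq _).trans ?_⟩
    rw [hDFc, ← hL, L.apply_symm_apply]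
  have hlag : ∀ v ∈ tangentPlane f y, ∀ w ∈ tangentPlane f y, kahlerForm v w = 0 :=
    (hf.specialLagrangian y).2.1
  refine ⟨jacobian_symm hΦ1 hproj fun v w => hlag _ (hmem v) _ (hmem w), L,
    fun a => (hDeq a).trans (hDFc a), fun (a : RThree) => ?_⟩
  have hD2 : chartHessian f y a a =
      fderiv ℝ (fderiv ℝ Φ) q (L a) (L a) + fderiv ℝ Φ q (fderiv ℝ (fderiv ℝ P) c a a) := by
    change fderiv ℝ (fderiv ℝ F) c a a = _
    rw [(hcomp.fderiv (𝕜 := ℝ)).fderiv_eq, fderiv_fderiv_comp hΦ' hP', hPc, hL]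
  have hda : differential f y a = fderiv ℝ Φ q (L a) := (hDeq a).trans (hDFc a)
  have hz := horizontal_fderiv_fderiv hΦ hproj (L a) (L a)
  refine (inner_starProjection_complexStructure hlag _ ⟨a, rfl⟩).trans ?_
  change -kahlerForm (chartHessian f y a a) (differential f y a) = _
  rw [hda, hD2, kahlerForm_eq_im_inner, inner_add_left, Complex.add_im, ← kahlerForm_eq_im_inner,
    ← kahlerForm_eq_im_inner, hlag _ (hmem _) _ (hmem _), add_zero,
    kahlerForm_fderiv hΦ1 hproj _ _ hz, neg_neg]
  refine Finset.sum_congr rfl fun i _ => ?_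
  rw [vertical_fderiv_fderiv hΦ, mul_comm]
  rfl

end CubicOfGraph

/-! ### Frames adapted to an `A₄`-symmetric cubic -/

section Frames

variable {M : Type*} [TopologicalSpace M] [ChartedSpace RThree M] {f : M → CThree}
  {e : OrthonormalBasis (Fin 3) ℂ CThree} {Φ : RThree → CThree}

theorem mul_mul_transpose_apply (A N : Matrix (Fin 3) (Fin 3) ℝ) (β γ : Fin 3) :
    (A * N * A.transpose) β γ = A β ⬝ᵥ N.mulVec (A γ) := by
  rw [Matrix.dotProduct_mulVec]
  rfl

/-- The third derivatives of the potential of a Lagrangian graph are symmetric in all indices. -/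
theorem componentHessian_symm {ε : Fin 3 → RThree} {G : Fin 3 → RThree → ℝ} {q : RThree}
    (hG : ∀ i, ContDiffAt ℝ 2 (G i) q)
    (hsymm : ∀ᶠ q' in 𝓝 q, (jacobian ε G q').transpose = jacobian ε G q') (i j k : Fin 3) :
    componentHessian ε (jacobian ε G) i q j k = componentHessian ε (jacobian ε G) j q i k ∧
      componentHessian ε (jacobian ε G) i q j k = componentHessian ε (jacobian ε G) i q k j := by
  refine ⟨?_, dirDeriv_comm (hG i) _ _⟩
  exact (dirDeriv_eventuallyEq (hsymm.mono fun q' hq' => congrFun (congrFun hq' j) i)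
    _).eq_of_nhds

/-- The trilinear form with coefficients `H i j k`, pulled back by a linear map `ℓ`. -/
noncomputable def coefficientForm {V : Type*} [AddCommGroup V] [Module ℝ V]
    (ℓ : V →ₗ[ℝ] (Fin 3 → ℝ)) (H : Fin 3 → Matrix (Fin 3) (Fin 3) ℝ) :
    V →ₗ[ℝ] V →ₗ[ℝ] V →ₗ[ℝ] ℝ :=
  ∑ i, (LinearMap.proj i ∘ₗ ℓ).smulRight ((Matrix.toLinearMap₂' ℝ (H i)).compl₁₂ ℓ ℓ)

section CoefficientForm

variable {V : Type*} [AddCommGroup V] [Module ℝ V] {ℓ : V →ₗ[ℝ] (Fin 3 → ℝ)}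
  {H : Fin 3 → Matrix (Fin 3) (Fin 3) ℝ}

theorem coefficientForm_apply (a b d : V) :
    coefficientForm ℓ H a b d = ∑ i, ℓ a i * (ℓ b ⬝ᵥ (H i).mulVec (ℓ d)) := by
  simp only [coefficientForm, LinearMap.sum_apply, LinearMap.smulRight_apply, LinearMap.smul_apply,
    LinearMap.compl₁₂_apply, Matrix.toLinearMap₂'_apply', smul_eq_mul]
  rfl

theorem coefficientForm_expand (a b d : V) :
    coefficientForm ℓ H a b d = ∑ i, ∑ j, ∑ k, H i j k * (ℓ a i * ℓ b j * ℓ d k) := by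
  rw [coefficientForm_apply]
  simp only [dotProduct, Matrix.mulVec, Finset.mul_sum]
  exact Finset.sum_congr rfl fun i _ => Finset.sum_congr rfl fun j _ =>
    Finset.sum_congr rfl fun k _ => by ring

theorem coefficientForm_symm (hH : ∀ i j k, H i j k = H j i k ∧ H i j k = H i k j) (a b d : V) :
    coefficientForm ℓ H a b d = coefficientForm ℓ H b a d ∧
      coefficientForm ℓ H a b d = coefficientForm ℓ H a d b := by
  simp only [coefficientForm_expand]
  constructor
  · rw [Finset.sum_comm]
    refine Finset.sum_congr rfl fun i _ => Finset.sum_congr rfl fun j _ =>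
      Finset.sum_congr rfl fun k _ => ?_
    rw [(hH j i k).1]; ring
  · refine Finset.sum_congr rfl fun i _ => ?_
    rw [Finset.sum_comm]
    refine Finset.sum_congr rfl fun j _ => Finset.sum_congr rfl fun k _ => ?_
    rw [(hH i k j).2]; ring

end CoefficientForm

/-- The polarization of the fundamental cubic. -/
noncomputable def polarizedCubic (f : M → CThree) (y : M) (a b d : TangentSpace (𝓡 3) y) : ℝ :=
  (fundamentalCubic f y (a + b + d) - fundamentalCubic f y (a + b) - fundamentalCubic f y (a + d) -
    fundamentalCubic f y (b + d) + fundamentalCubic f y a + fundamentalCubic f y b +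
    fundamentalCubic f y d) / 6

/-- The coordinates on the tangent space provided by a linear isomorphism with the model space. -/
noncomputable def tangentCoord {y : M} (L : TangentSpace (𝓡 3) y ≃ₗ[ℝ] RThree) :
    TangentSpace (𝓡 3) y →ₗ[ℝ] (Fin 3 → ℝ) :=
  (WithLp.linearEquiv 2 ℝ (Fin 3 → ℝ)).toLinearMap ∘ₗ L.toLinearMap

theorem polarizedCubic_eq {y : M} {H : Fin 3 → Matrix (Fin 3) (Fin 3) ℝ}
    (hH : ∀ i j k, H i j k = H j i k ∧ H i j k = H i k j)
    {L : TangentSpace (𝓡 3) y ≃ₗ[ℝ] RThree}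
    (hC : ∀ a, fundamentalCubic f y a =
      ∑ i, L a i * (WithLp.ofLp (L a) ⬝ᵥ (H i).mulVec (WithLp.ofLp (L a))))
    (a b d : TangentSpace (𝓡 3) y) :
    polarizedCubic f y a b d = coefficientForm (tangentCoord L) H a b d := by
  have h : ∀ a, coefficientForm (tangentCoord L) H a a a = fundamentalCubic f y a := fun a => by
    rw [hC, coefficientForm_apply]; rfl
  rw [trilinear_eq_polarization (fun x y z => (coefficientForm_symm hH x y z).1)
    (fun x y z => (coefficientForm_symm hH x y z).2)]
  simp only [h]
  rfl

/-- At a point where the fundamental cubic has an `A₄`-symmetry it is a multiple of `x₀ x₁ x₂` in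
an orthonormal frame of the tangent space. -/
theorem exists_frame_of_hasA4SymmetryAt (hf : IsSpecialLagrangianImmersion f) {y : M}
    {g : Matrix (Fin 3) (Fin 3) ℝ} {H : Fin 3 → Matrix (Fin 3) (Fin 3) ℝ}
    (hH : ∀ i j k, H i j k = H j i k ∧ H i j k = H i k j)
    {L : TangentSpace (𝓡 3) y ≃ₗ[ℝ] RThree}
    (hg : ∀ a b, firstFundamentalForm f y a b = WithLp.ofLp (L a) ⬝ᵥ g.mulVec (WithLp.ofLp (L b)))
    (hC : ∀ a, fundamentalCubic f y a =
      ∑ i, L a i * (WithLp.ofLp (L a) ⬝ᵥ (H i).mulVec (WithLp.ofLp (L a))))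
    (hA : HasA4SymmetryAt f y) :
    ∃ (b : Fin 3 → TangentSpace (𝓡 3) y) (s : ℝ),
      (∀ i j, firstFundamentalForm f y (b i) (b j) = if i = j then 1 else 0) ∧
      ∀ i j k, polarizedCubic f y (b i) (b j) (b k) = s * distinctSymbol i j k := by
  obtain ⟨K, hK, ⟨eK⟩⟩ := hA
  let gl : TangentSpace (𝓡 3) y →ₗ[ℝ] TangentSpace (𝓡 3) y →ₗ[ℝ] ℝ :=
    (Matrix.toLinearMap₂' ℝ g).compl₁₂ (tangentCoord L) (tangentCoord L)
  have hgl : ∀ a b, gl a b = firstFundamentalForm f y a b := by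
    intro a b
    rw [hg, LinearMap.compl₁₂_apply, Matrix.toLinearMap₂'_apply']
    rfl
  have hcC : ∀ a, coefficientForm (tangentCoord L) H a a a = fundamentalCubic f y a := fun a => by
    rw [hC, coefficientForm_apply]; rfl
  have hfin : Module.finrank ℝ (TangentSpace (𝓡 3) y) = 3 := by
    rw [L.finrank_eq]; simp
  obtain ⟨b, s, hb, hs⟩ := exists_orthonormal_frame_of_invariant hfin (g := gl)
    (c := coefficientForm (tangentCoord L) H)
    (fun x hx => by
      rw [hgl]
      refine real_inner_self_pos.2 fun h => hx ?_
      exact hf.immersive y (h.trans (map_zero (differential f y)).symm))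
    (fun x y z => (coefficientForm_symm hH x y z).1)
    (fun x y z => (coefficientForm_symm hH x y z).2)
    eK
    (fun A hA x y' => by rw [hgl, hgl]; exact (hK hA).1 x y')
    (fun A hA => (hK hA).2.1)
    (fun A hA x => by rw [hcC, hcC]; exact (hK hA).2.2 x)
  exact ⟨b, s, fun i j => by rw [← hgl, hb], fun i j k => by rw [polarizedCubic_eq hH hC, hs]⟩

end Frames

/-! ### Vanishing of the fundamental cubic -/

section Vanishing

variable {M : Type*} [TopologicalSpace M] [ChartedSpace RThree M]
  {f : M → CThree} {e : OrthonormalBasis (Fin 3) ℂ CThree} {Φ : RThree → CThree}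

/-- Near `y` the immersion `f` is the graph `Φ` over the horizontal coordinates of the unitary
basis `e`, and `y` lies over `q`. -/
structure IsGraphAt (f : M → CThree) (e : OrthonormalBasis (Fin 3) ℂ CThree)
    (Φ : RThree → CThree) (q : RThree) (y : M) : Prop where
  horizontal_eq : horizontal e (f y) = q
  contDiffAt : ContDiffAt ℝ 4 Φ q
  section_eq : ∀ᶠ q' in 𝓝 q, horizontal e (Φ q') = q'
  graph_eq : ∀ᶠ y' in 𝓝 y, Φ (horizontal e (f y')) = f y'

theorem exists_isGraphAt [IsManifold (𝓡 3) ∞ M] (hf : IsSpecialLagrangianImmersion f) (x : M)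
    (he : ∀ w ∈ tangentPlane f x, ∀ i, vertical e i w = 0) :
    ∃ Φ : RThree → CThree, IsGraphAt f e Φ (horizontal e (f x)) x ∧ (∀ q, Φ q ∈ Set.range f) ∧
      ∀ᶠ q in 𝓝 (horizontal e (f x)), ∃ y, IsGraphAt f e Φ q y := by
  obtain ⟨η, hη, hsm, hsec, hgr⟩ := exists_local_graph hf x he
  refine ⟨f ∘ η, ⟨rfl, hsm, hsec, hgr⟩, fun q => ⟨η q, rfl⟩, ?_⟩
  filter_upwards [hsm.eventually (by simp), hsec.eventually_nhds, hη.eventually hgr.eventually_nhds]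
    with q h1 h2 h3
  exact ⟨η q, h2.self_of_nhds, h1, h2, h3⟩

/-- The second derivatives of the vertical components of the graph `Φ`. -/
noncomputable abbrev graphHessian (e : OrthonormalBasis (Fin 3) ℂ CThree) (Φ : RThree → CThree)
    (q : RThree) (i : Fin 3) : Matrix (Fin 3) (Fin 3) ℝ :=
  componentHessian stdVec (jacobian stdVec (verticalPart e Φ)) i q

theorem contDiffAt_verticalPart {n : ℕ∞ω} {q : RThree} (h : ContDiffAt ℝ n Φ q) (i : Fin 3) :
    ContDiffAt ℝ n (verticalPart e Φ i) q :=
  (vertical e i).contDiff.contDiffAt.comp q h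

/-- The geometry of the immersion at `y` expressed by the graph `Φ`. -/
theorem IsGraphAt.exists_linearEquiv [IsManifold (𝓡 3) ∞ M] (hf : IsSpecialLagrangianImmersion f)
    {q : RThree} {y : M} (h : IsGraphAt f e Φ q y) :
    ∃ L : TangentSpace (𝓡 3) y ≃ₗ[ℝ] RThree,
      (∀ a, L a = horizontal e (differential f y a)) ∧
      (∀ a, differential f y a = fderiv ℝ Φ q (L a)) ∧
      (∀ a b, firstFundamentalForm f y a b = WithLp.ofLp (L a) ⬝ᵥ
        (graphMetric (jacobian stdVec (verticalPart e Φ) q)).mulVec (WithLp.ofLp (L b))) ∧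
      ∀ a, fundamentalCubic f y a = ∑ i, L a i * (WithLp.ofLp (L a) ⬝ᵥ
        (graphHessian e Φ q i).mulVec (WithLp.ofLp (L a))) := by
  have hΦ := h.contDiffAt.differentiableAt (by norm_num)
  obtain ⟨-, L, hL, hC⟩ := exists_linearEquiv_fundamentalCubic hf h.horizontal_eq
    (h.contDiffAt.of_le (by norm_num)) h.section_eq h.graph_eq
  refine ⟨L, fun a => ?_, hL, fun a b => ?_, hC⟩
  · rw [hL, horizontal_fderiv hΦ h.section_eq]
  · rw [firstFundamentalForm, hL, hL, inner_fderiv hΦ h.section_eq]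

theorem IsGraphAt.jacobian_symm [IsManifold (𝓡 3) ∞ M] (hf : IsSpecialLagrangianImmersion f)
    {q : RThree} {y : M} (h : IsGraphAt f e Φ q y) :
    (jacobian stdVec (verticalPart e Φ) q).transpose = jacobian stdVec (verticalPart e Φ) q :=
  (exists_linearEquiv_fundamentalCubic hf h.horizontal_eq
    (h.contDiffAt.of_le (by norm_num)) h.section_eq h.graph_eq).1

theorem graphHessian_symm [IsManifold (𝓡 3) ∞ M] (hf : IsSpecialLagrangianImmersion f)
    {q : RThree} (h : ∀ᶠ q' in 𝓝 q, ∃ y, IsGraphAt f e Φ q' y) (i j k : Fin 3) :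
    graphHessian e Φ q i j k = graphHessian e Φ q j i k ∧
      graphHessian e Φ q i j k = graphHessian e Φ q i k j := by
  obtain ⟨y, hy⟩ := h.self_of_nhds
  refine componentHessian_symm
    (fun i => contDiffAt_verticalPart (hy.contDiffAt.of_le (by norm_num)) i) ?_ i j k
  filter_upwards [h] with q' ⟨y', hy'⟩
  exact hy'.jacobian_symm hf

theorem exists_adapted_basis (hf : IsSpecialLagrangianImmersion f) (x : M) :
    ∃ e : OrthonormalBasis (Fin 3) ℂ CThree, ∀ w ∈ tangentPlane f x, ∀ i, vertical e i w = 0 := by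
  have h3 := (hf.specialLagrangian x).1
  let b := (stdOrthonormalBasis ℝ (tangentPlane f x)).reindex (finCongr h3)
  obtain ⟨e, -, he⟩ := exists_unitary_basis (hf.specialLagrangian x).2.1
    (v := fun i => (b i : CThree)) (fun i => (b i).2)
    (fun i j => by
      have := orthonormal_iff_ite.1 b.orthonormal i j
      simpa using this)
  exact ⟨e, he⟩

/-- The graph over the tangent plane at `x` is horizontal at `x`. -/
theorem jacobian_eq_zero_of_adapted [IsManifold (𝓡 3) ∞ M] (hf : IsSpecialLagrangianImmersion f)
    {x : M} (he : ∀ w ∈ tangentPlane f x, ∀ i, vertical e i w = 0) {q : RThree}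
    (h : IsGraphAt f e Φ q x) : jacobian stdVec (verticalPart e Φ) q = 0 := by
  obtain ⟨L, -, hL, -, -⟩ := h.exists_linearEquiv hf
  ext i j
  have h1 := he (fderiv ℝ Φ q (stdVec j)) ⟨L.symm (stdVec j), by
    change differential f x (L.symm (stdVec j)) = _
    rw [hL, L.apply_symm_apply]⟩ i
  rw [vertical_fderiv (h.contDiffAt.differentiableAt (by norm_num))] at h1
  simpa [stdVec] using h1

/-- If the fundamental cubic has an `A₄`-symmetry at every point, it vanishes identically. -/
theorem fundamentalCubic_eq_zero [IsManifold (𝓡 3) ∞ M] (hf : IsSpecialLagrangianImmersion f)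
    (hA : ∀ y, HasA4SymmetryAt f y) (x : M) (a : TangentSpace (𝓡 3) x) :
    fundamentalCubic f x a = 0 := by
  -- an orthonormal frame of the tangent space in which the cubic is a multiple of `x₀ x₁ x₂`
  obtain ⟨b, s, hb, hs⟩ : ∃ (b : Fin 3 → TangentSpace (𝓡 3) x) (s : ℝ),
      (∀ i j, firstFundamentalForm f x (b i) (b j) = if i = j then 1 else 0) ∧
      ∀ i j k, polarizedCubic f x (b i) (b j) (b k) = s * distinctSymbol i j k := by
    obtain ⟨e, he⟩ := exists_adapted_basis hf x
    obtain ⟨Φ, h, -, hev⟩ := exists_isGraphAt hf x he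
    obtain ⟨L, -, -, hg, hC⟩ := h.exists_linearEquiv hf
    exact exists_frame_of_hasA4SymmetryAt hf (graphHessian_symm hf hev) hg hC (hA x)
  -- the graph in coordinates adapted to this frame
  obtain ⟨e, heb, he⟩ := exists_unitary_basis (hf.specialLagrangian x).2.1
    (v := fun i => differential f x (b i)) (fun i => ⟨b i, rfl⟩) hb
  obtain ⟨Φ, h, -, hev⟩ := exists_isGraphAt hf x he
  obtain ⟨L, hLh, -, -, hC⟩ := h.exists_linearEquiv hf
  have hLb : ∀ i, L (b i) = stdVec i := by
    intro i
    rw [hLh, ← heb]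
    ext j
    rw [horizontal_apply, e.repr_self]
    by_cases hij : j = i <;> simp [stdVec, hij]
  have hzero : ∀ i, graphHessian e Φ (horizontal e (f x)) i = 0 := by
    refine componentHessian_eq_zero_of_frames
      (fun i => contDiffAt_verticalPart h.contDiffAt i) ?_
      (jacobian_eq_zero_of_adapted hf he h) ⟨s, fun i j k => ?_⟩ ?_
    · filter_upwards [hev] with q' ⟨y', hy'⟩
      exact hy'.jacobian_symm hf
    · rw [← hs, polarizedCubic_eq (graphHessian_symm hf hev) hC, coefficientForm_apply]
      simp [tangentCoord, hLb, stdVec]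
    · filter_upwards [hev, hev.eventually_nhds] with q ⟨y, hy⟩ hq
      obtain ⟨L, -, -, hg, hC⟩ := hy.exists_linearEquiv hf
      obtain ⟨b, s, hb, hs⟩ :=
        exists_frame_of_hasA4SymmetryAt hf (graphHessian_symm hf hq) hg hC (hA y)
      refine ⟨Matrix.of fun i => WithLp.ofLp (L (b i)), s, ?_, fun α β γ => ?_⟩
      · ext i j
        rw [mul_mul_transpose_apply, Matrix.one_apply, ← hb, hg]
        rfl
      · rw [← hs, polarizedCubic_eq (graphHessian_symm hf hq) hC, coefficientForm_apply]
        refine Finset.sum_congr rfl fun i _ => ?_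
        rw [mul_mul_transpose_apply]
        rfl
  rw [hC]
  simp [hzero]

end Vanishing

/-! ### Planarity -/

section Planarity

variable {M : Type*} [TopologicalSpace M] [ChartedSpace RThree M]
  {f : M → CThree} {e : OrthonormalBasis (Fin 3) ℂ CThree} {Φ : RThree → CThree}

/-- The tangent plane at `x` is exactly the horizontal space of a unitary basis adapted to it. -/
theorem mem_tangentPlane_of_vertical_eq_zero (hf : IsSpecialLagrangianImmersion f) {x : M}
    (he : ∀ w ∈ tangentPlane f x, ∀ i, vertical e i w = 0) {z : CThree}
    (hz : ∀ i, vertical e i z = 0) : z ∈ tangentPlane f x := by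
  let W : Submodule ℝ CThree := ⨅ i, LinearMap.ker (vertical e i).toLinearMap
  have hW : ∀ z, z ∈ W ↔ ∀ i, vertical e i z = 0 := fun z => by simp [W, Submodule.mem_iInf]
  have hle : tangentPlane f x ≤ W := fun w hw => (hW w).2 (he w hw)
  have hinj : Function.Injective ((horizontal e).toLinearMap ∘ₗ W.subtype) := by
    intro z w hzw
    refine Subtype.ext (ext_horizontal_vertical e hzw fun i => ?_)
    rw [(hW _).1 z.2 i, (hW _).1 w.2 i]
  have hdim : Module.finrank ℝ W ≤ 3 := by
    have := LinearMap.finrank_le_finrank_of_injective hinj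
    simpa using this
  have heq := Submodule.eq_of_le_of_finrank_le hle (by rwa [(hf.specialLagrangian x).1])
  rw [heq]
  exact (hW z).2 hz

variable [IsManifold (𝓡 3) ∞ M]

/-- A linear map that is constant along the immersion near `y` annihilates the first and second
derivatives of the immersion at `y`. -/
theorem map_differential_eq_zero (hf : ContMDiff (𝓡 3) 𝓘(ℝ, CThree) ∞ f) {y : M}
    {F : Type*} [NormedAddCommGroup F] [NormedSpace ℝ F] (T : CThree →L[ℝ] F) {w : F}
    (hT : ∀ᶠ y' in 𝓝 y, T (f y') = w) :
    (∀ a, T (differential f y a) = 0) ∧ ∀ a b, T (chartHessian f y a b) = 0 := by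
  set c := extChartAt (𝓡 3) y y with hc
  have hF : ContDiffAt ℝ 2 (inChart f y) c :=
    mod_cast contDiffAt_infty.1 (contDiffAt_inChart hf y) 2
  have ht := (continuousAt_extChartAt_symm (I := 𝓡 3) y).tendsto
  rw [extChartAt_to_inv] at ht
  have hcomp : (fun c' => T (inChart f y c')) =ᶠ[𝓝 c] fun _ => w := ht.eventually hT
  have hD : (fun c' => T.comp (fderiv ℝ (inChart f y) c')) =ᶠ[𝓝 c] fun _ => 0 := by
    filter_upwards [hcomp.fderiv (𝕜 := ℝ), hF.eventually (by simp)] with c' h1 h2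
    have h3 := (T.hasFDerivAt.comp c' (h2.differentiableAt (by norm_num)).hasFDerivAt).fderiv
    rw [← h3]
    refine h1.trans ?_
    simp
  constructor
  · intro a
    rw [differential_eq_fderiv hf]
    exact congrArg (fun S : RThree →L[ℝ] F => S a) hD.self_of_nhds
  · intro a b
    have hF2 : DifferentiableAt ℝ (fderiv ℝ (inChart f y)) c :=
      (hF.fderiv_right (m := 1) (by norm_num)).differentiableAt (by norm_num)
    have h1 := ((ContinuousLinearMap.compL ℝ RThree CThree F T).hasFDerivAt.comp c
      hF2.hasFDerivAt).fderiv
    have h2 : fderiv ℝ (fun c' => T.comp (fderiv ℝ (inChart f y) c')) c = 0 := by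
      rw [hD.fderiv_eq]; simp
    have h3 := h1.symm.trans h2
    exact congrArg (fun S : RThree →L[ℝ] RThree →L[ℝ] F => S a b) h3

theorem fderiv_eq_zero_of_dirDeriv {φ : RThree → ℝ} {q : RThree}
    (h : ∀ j, dirDeriv (stdVec j) φ q = 0) : fderiv ℝ φ q = 0 := by
  ext v
  rw [← sum_smul_stdVec v, map_sum]
  simp only [map_smul]
  have h' : ∀ j, fderiv ℝ φ q (stdVec j) = 0 := h
  simp [h']

/-- If the fundamental cubic vanishes identically, the vertical components of a local graph over
the tangent plane at `x` are constant. -/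
theorem eventually_vertical_eq (hf : IsSpecialLagrangianImmersion f)
    (hC : ∀ y a, fundamentalCubic f y a = 0) {x : M}
    (he : ∀ w ∈ tangentPlane f x, ∀ i, vertical e i w = 0)
    (h : IsGraphAt f e Φ (horizontal e (f x)) x)
    (hev : ∀ᶠ q in 𝓝 (horizontal e (f x)), ∃ y, IsGraphAt f e Φ q y) :
    ∀ᶠ q in 𝓝 (horizontal e (f x)), ∀ i, vertical e i (Φ q) = vertical e i (f x) := by
  set p := horizontal e (f x) with hp
  -- the third derivatives of the potential are the polarized cubic, hence zero; on a ball the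
  -- Jacobian is then constant, and it vanishes at the centre
  have hH : ∀ᶠ q in 𝓝 p, ∀ i, graphHessian e Φ q i = 0 := by
    filter_upwards [hev, hev.eventually_nhds] with q ⟨y, hy⟩ hq i
    obtain ⟨L, -, -, -, hCy⟩ := hy.exists_linearEquiv hf
    ext j k
    have h1 := polarizedCubic_eq (graphHessian_symm hf hq) hCy (L.symm (stdVec i))
      (L.symm (stdVec j)) (L.symm (stdVec k))
    rw [coefficientForm_apply] at h1
    simp [polarizedCubic, hC, tangentCoord, stdVec] at h1
    exact h1.symm
  obtain ⟨r, hr, hball⟩ := Metric.eventually_nhds_iff_ball.1 (hH.and hev)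
  have hpre : IsPreconnected (Metric.ball p r) := (convex_ball p r).isPreconnected
  have hpb : p ∈ Metric.ball p r := Metric.mem_ball_self hr
  have hsm : ∀ q ∈ Metric.ball p r, ∀ i, ContDiffAt ℝ 4 (verticalPart e Φ i) q := by
    intro q hq i
    obtain ⟨y, hy⟩ := (hball q hq).2
    exact contDiffAt_verticalPart hy.contDiffAt i
  have hU : ∀ q ∈ Metric.ball p r, ∀ i j, dirDeriv (stdVec j) (verticalPart e Φ i) q = 0 := by
    intro q hq i j
    have hconst := Metric.isOpen_ball.is_const_of_fderiv_eq_zero hpre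
      (f := dirDeriv (stdVec j) (verticalPart e Φ i))
      (fun q hq => ((contDiffAt_dirDeriv (hsm q hq i) (m := 1) (by norm_num) _).differentiableAt
        (by norm_num)).differentiableWithinAt)
      (fun q hq => fderiv_eq_zero_of_dirDeriv fun k =>
        congrFun (congrFun ((hball q hq).1 i) j) k) hq hpb
    rw [hconst]
    exact congrFun (congrFun (jacobian_eq_zero_of_adapted hf he h) i) j
  filter_upwards [Metric.ball_mem_nhds p hr] with q hq i
  have hconst := Metric.isOpen_ball.is_const_of_fderiv_eq_zero hpre (f := verticalPart e Φ i)
    (fun q hq => ((hsm q hq i).differentiableAt (by norm_num)).differentiableWithinAt)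
    (fun q hq => fderiv_eq_zero_of_dirDeriv (hU q hq i)) hq hpb
  have hx : Φ p = f x := h.graph_eq.self_of_nhds
  rw [← hx]
  exact hconst

/-- If the fundamental cubic vanishes identically, the immersed submanifold coincides near each of
its points with its affine tangent plane. -/
theorem eventually_planar (hf : IsSpecialLagrangianImmersion f)
    (hC : ∀ y a, fundamentalCubic f y a = 0) (x : M) :
    (∀ᶠ y in 𝓝 x, f y - f x ∈ tangentPlane f x ∧ tangentPlane f y = tangentPlane f x) ∧
      ∀ᶠ z in 𝓝 (f x), z - f x ∈ tangentPlane f x → z ∈ Set.range f := by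
  obtain ⟨e, he⟩ := exists_adapted_basis hf x
  obtain ⟨Φ, h, hrange, hev⟩ := exists_isGraphAt hf x he
  have hv := eventually_vertical_eq hf hC he h hev
  constructor
  · have hcont : ContinuousAt (fun y => horizontal e (f y)) x :=
      ((horizontal e).continuous.comp hf.smooth.continuous).continuousAt
    have hfv : ∀ᶠ y in 𝓝 x, ∀ i, vertical e i (f y) = vertical e i (f x) := by
      filter_upwards [hcont.eventually hv, h.graph_eq] with y h1 h2 i
      rw [← h2, h1 i]
    filter_upwards [hfv, hfv.eventually_nhds] with y h1 h2
    refine ⟨mem_tangentPlane_of_vertical_eq_zero hf he fun i => by rw [map_sub, h1 i, sub_self], ?_⟩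
    have hle : tangentPlane f y ≤ tangentPlane f x := by
      rintro _ ⟨a, rfl⟩
      exact mem_tangentPlane_of_vertical_eq_zero hf he fun i =>
        (map_differential_eq_zero hf.smooth (vertical e i) (h2.mono fun y' hy' => hy' i)).1 a
    exact Submodule.eq_of_le_of_finrank_eq hle
      (by rw [(hf.specialLagrangian y).1, (hf.specialLagrangian x).1])
  · have hcont : ContinuousAt (horizontal e) (f x) := (horizontal e).continuous.continuousAt
    filter_upwards [hcont.eventually hv, hcont.eventually h.section_eq] with z h1 h2 hz
    have : Φ (horizontal e z) = z := by
      refine ext_horizontal_vertical e h2 fun i => ?_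
      rw [h1 i]
      have := he _ hz i
      rw [map_sub, sub_eq_zero] at this
      exact this.symm
    rw [← this]
    exact hrange _

/-- A connected special Lagrangian immersion with vanishing fundamental cubic is open in a special
Lagrangian plane. -/
theorem exists_plane_of_fundamentalCubic_eq_zero [ConnectedSpace M]
    (hf : IsSpecialLagrangianImmersion f) (hC : ∀ y a, fundamentalCubic f y a = 0) :
    ∃ P : AffineSubspace ℝ CThree, IsSpecialLagrangianPlane P ∧
      Set.range f ⊆ (P : Set CThree) ∧ IsOpen {p : P | (p : CThree) ∈ Set.range f} := by
  let plane : M → AffineSubspace ℝ CThree := fun y => AffineSubspace.mk' (f y) (tangentPlane f y)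
  have hloc : IsLocallyConstant plane := by
    rw [IsLocallyConstant.iff_eventually_eq]
    intro x
    filter_upwards [(eventually_planar hf hC x).1] with y ⟨h1, h2⟩
    simp only [plane, h2]
    refine (AffineSubspace.eq_iff_direction_eq_of_mem (AffineSubspace.self_mem_mk' (f y) _) ?_).2
      (by rw [AffineSubspace.direction_mk', AffineSubspace.direction_mk'])
    rw [AffineSubspace.mem_mk', vsub_eq_sub]
    exact h1
  obtain ⟨x₀⟩ := (inferInstance : Nonempty M)
  have hplane : ∀ y, plane y = plane x₀ := fun y =>
    hloc.apply_eq_of_preconnectedSpace y x₀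
  refine ⟨plane x₀, ⟨⟨f x₀, AffineSubspace.self_mem_mk' _ _⟩, ?_⟩, ?_, ?_⟩
  · rw [AffineSubspace.direction_mk']
    exact hf.specialLagrangian x₀
  · rintro _ ⟨y, rfl⟩
    rw [← hplane y]
    exact AffineSubspace.self_mem_mk' _ _
  · rw [isOpen_iff_mem_nhds]
    rintro ⟨_, hp⟩ ⟨x, rfl⟩
    have h : ∀ᶠ z : plane x₀ in 𝓝 ⟨f x, hp⟩,
        (z : CThree) - f x ∈ tangentPlane f x → (z : CThree) ∈ Set.range f :=
      (continuous_subtype_val.tendsto (⟨f x, hp⟩ : plane x₀)).eventually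
        (eventually_planar hf hC x).2
    filter_upwards [h] with z hz
    refine hz ?_
    have hz' : (z : CThree) ∈ plane x := by rw [hplane x]; exact z.2
    rwa [AffineSubspace.mem_mk', vsub_eq_sub] at hz'

end Planarity

/-! ### The tetrahedral group and planar immersions -/

section Tetrahedral

/-- The coordinates of the vertices of a regular tetrahedron centred at the origin: the columns are
the vertices, the rows are pairwise orthogonal and orthogonal to `(1, 1, 1, 1)`. -/
def tetrahedron : Matrix (Fin 3) (Fin 4) ℝ := !![1, 1, -1, -1; 1, -1, 1, -1; 1, -1, -1, 1]

/-- The inner products of the vertices; as a sum over `i` this is the completeness relation of the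
rows of `tetrahedron` in the orthogonal complement of `(1, 1, 1, 1)`. -/
theorem tetrahedron_inner (k m : Fin 4) :
    ∑ i, tetrahedron i k * tetrahedron i m = 4 * (if k = m then 1 else 0) - 1 := by
  fin_cases k <;> fin_cases m <;> simp [tetrahedron, Fin.sum_univ_three] <;> norm_num

theorem tetrahedron_sum (i : Fin 3) : ∑ k, tetrahedron i k = 0 := by
  fin_cases i <;> simp [tetrahedron, Fin.sum_univ_four]

/-- The action of a permutation of the vertices of the tetrahedron as a matrix. -/
noncomputable def tetrahedralMatrix (σ : Equiv.Perm (Fin 4)) : Matrix (Fin 3) (Fin 3) ℝ :=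
  Matrix.of fun i j => (∑ k, tetrahedron i (σ k) * tetrahedron j k) / 4

theorem tetrahedralMatrix_one : tetrahedralMatrix 1 = 1 := by
  ext i j
  fin_cases i <;> fin_cases j <;>
    simp [tetrahedralMatrix, tetrahedron, Fin.sum_univ_four] <;> norm_num

theorem tetrahedralMatrix_mul (σ τ : Equiv.Perm (Fin 4)) :
    tetrahedralMatrix (σ * τ) = tetrahedralMatrix σ * tetrahedralMatrix τ := by
  ext i j
  have h : ∑ l, (∑ k, tetrahedron i (σ k) * tetrahedron l k) *
      (∑ n, tetrahedron l (τ n) * tetrahedron j n) =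
      4 * ∑ n, tetrahedron i (σ (τ n)) * tetrahedron j n := by
    calc _ = ∑ k, ∑ n, tetrahedron i (σ k) * tetrahedron j n *
          ∑ l, tetrahedron l k * tetrahedron l (τ n) := by
          simp only [Finset.sum_mul, Finset.mul_sum]
          rw [Finset.sum_comm]
          conv_rhs =>
            enter [2, k]
            rw [Finset.sum_comm]
          conv_lhs =>
            rw [Finset.sum_comm]
            enter [2, l]
            rw [Finset.sum_comm]
          rw [Finset.sum_comm]
          refine Finset.sum_congr rfl fun k _ => Finset.sum_congr rfl fun l _ =>
            Finset.sum_congr rfl fun n _ => by ring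
      _ = 4 * ∑ n, tetrahedron i (σ (τ n)) * tetrahedron j n -
          (∑ k, tetrahedron i (σ k)) * ∑ n, tetrahedron j n := by
          simp only [tetrahedron_inner, mul_sub, Finset.sum_sub_distrib, mul_one,
            Finset.sum_mul_sum]
          congr 1
          rw [Finset.sum_comm, Finset.mul_sum]
          refine Finset.sum_congr rfl fun n _ => ?_
          rw [Finset.sum_eq_single (τ n) (fun k _ hk => by simp [hk]) (by simp)]
          simp; ring
      _ = _ := by rw [tetrahedron_sum, mul_zero, sub_zero]
  simp only [tetrahedralMatrix, Matrix.of_apply, Matrix.mul_apply, Equiv.Perm.coe_mul,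
    Function.comp_apply, div_mul_div_comm]
  rw [← Finset.sum_div, h]
  ring

/-- The representation of the symmetric group by symmetries of the tetrahedron. -/
noncomputable def tetrahedralHom : Equiv.Perm (Fin 4) →* Matrix (Fin 3) (Fin 3) ℝ where
  toFun := tetrahedralMatrix
  map_one' := tetrahedralMatrix_one
  map_mul' := tetrahedralMatrix_mul

theorem tetrahedralMatrix_transpose_mul (σ : Equiv.Perm (Fin 4)) :
    (tetrahedralMatrix σ).transpose * tetrahedralMatrix σ = 1 := by
  have h : (tetrahedralMatrix σ).transpose = tetrahedralMatrix σ⁻¹ := by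
    ext i j
    simp only [tetrahedralMatrix, Matrix.transpose_apply, Matrix.of_apply]
    rw [← Equiv.sum_comp σ fun k => tetrahedron i (σ⁻¹ k) * tetrahedron j k]
    simp [mul_comm]
  rw [h, ← tetrahedralMatrix_mul, inv_mul_cancel, tetrahedralMatrix_one]

/-- The action is faithful: the trace is one less than the number of fixed vertices. -/
theorem eq_one_of_tetrahedralMatrix_eq_one {σ : Equiv.Perm (Fin 4)}
    (h : tetrahedralMatrix σ = 1) : σ = 1 := by
  have htr : ∑ k, (4 * (if σ k = k then 1 else 0) - 1 : ℝ) = 12 := by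
    have h1 : (tetrahedralMatrix σ).trace = 3 := by rw [h]; simp
    simp only [Matrix.trace, Matrix.diag, tetrahedralMatrix, Matrix.of_apply] at h1
    rw [← Finset.sum_div, Finset.sum_comm] at h1
    simp only [tetrahedron_inner] at h1
    linarith
  have h0 : ∑ k, (1 - (if σ k = k then 1 else 0) : ℝ) = 0 := by
    simp only [Finset.sum_sub_distrib, ← Finset.mul_sum] at htr ⊢
    simp at htr ⊢
    linarith
  rw [Finset.sum_eq_zero_iff_of_nonneg fun k _ => by split_ifs <;> norm_num] at h0
  ext1 k
  by_contra hk
  have := h0 k (Finset.mem_univ k)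
  simp only [Equiv.Perm.coe_one, id_eq] at hk
  simp [hk] at this

/-- Even permutations act by rotations: this holds for three-cycles, whose cube is the identity, and
these generate the alternating group. -/
theorem det_tetrahedralMatrix {σ : Equiv.Perm (Fin 4)} (hσ : σ ∈ alternatingGroup (Fin 4)) :
    (tetrahedralMatrix σ).det = 1 := by
  let d : Equiv.Perm (Fin 4) →* ℝ := Matrix.detMonoidHom.comp tetrahedralHom
  have hle : alternatingGroup (Fin 4) ≤ d.ker := by
    rw [← Equiv.Perm.closure_three_cycles_eq_alternating, Subgroup.closure_le]
    intro τ hτ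
    have h3 : d τ ^ 3 = 1 := by
      have ht : τ ^ 3 = 1 := by
        rw [← (show τ.IsThreeCycle from hτ).orderOf]; exact pow_orderOf_eq_one τ
      rw [← map_pow, ht, map_one]
    change d τ = 1
    nlinarith [sq_nonneg (d τ + 1), sq_nonneg (d τ - 1), sq_nonneg (d τ)]
  exact hle hσ

/-- In any basis of a real 3-space, the rotations of the tetrahedron form a group of linear maps
isomorphic to `A₄`. -/
theorem exists_subgroup_alternatingGroup {V : Type*} [AddCommGroup V] [Module ℝ V]
    (b : Module.Basis (Fin 3) ℝ V) :
    ∃ K : Subgroup (V ≃ₗ[ℝ] V), Nonempty (K ≃* alternatingGroup (Fin 4)) ∧ ∀ A ∈ K,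
      LinearEquiv.det A = 1 ∧
      ∀ a c, ⇑(b.repr (A a)) ⬝ᵥ ⇑(b.repr (A c)) = ⇑(b.repr a) ⬝ᵥ ⇑(b.repr c) := by
  let φ : alternatingGroup (Fin 4) →* Module.End ℝ V :=
    ((Matrix.toLinAlgEquiv b : _ ≃ₐ[ℝ] _).toAlgHom : _ →* _).comp
      (tetrahedralHom.comp (alternatingGroup (Fin 4)).subtype)
  let ρ : alternatingGroup (Fin 4) →* (V ≃ₗ[ℝ] V) :=
    (LinearMap.GeneralLinearGroup.generalLinearEquiv ℝ V).toMonoidHom.comp φ.toHomUnits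
  have hρ : ∀ σ a, ρ σ a = Matrix.toLin b b (tetrahedralMatrix σ) a := fun σ a => rfl
  have hρinj : Function.Injective ρ := by
    rw [injective_iff_map_eq_one]
    intro σ hσ
    apply Subtype.ext
    apply eq_one_of_tetrahedralMatrix_eq_one
    apply (Matrix.toLin b b).injective
    rw [Matrix.toLin_one]
    ext1 a
    rw [← hρ, hσ]
    rfl
  refine ⟨ρ.range, ⟨(MonoidHom.ofInjective hρinj).symm⟩, ?_⟩
  rintro _ ⟨σ, rfl⟩
  refine ⟨Units.ext ?_, fun a c => ?_⟩
  · have h : LinearMap.det (Matrix.toLin b b (tetrahedralMatrix σ)) = 1 := by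
      rw [LinearMap.det_toLin, det_tetrahedralMatrix σ.2]
    rw [LinearEquiv.coe_det]
    exact h
  · have hrepr : ∀ a, ⇑(b.repr (ρ σ a)) = (tetrahedralMatrix σ).mulVec ⇑(b.repr a) := fun a => by
      rw [hρ, Matrix.repr_toLin]
    rw [hrepr, hrepr, Matrix.dotProduct_mulVec, ← Matrix.mulVec_transpose, Matrix.mulVec_mulVec,
      tetrahedralMatrix_transpose_mul, Matrix.one_mulVec]

end Tetrahedral

section Converse

variable {M : Type*} [TopologicalSpace M] [ChartedSpace RThree M] {f : M → CThree}

theorem inner_eq_dotProduct_repr {V W : Type*} [AddCommGroup V] [Module ℝ V]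
    [NormedAddCommGroup W] [InnerProductSpace ℝ W] (D : V ≃ₗ[ℝ] W)
    (o : OrthonormalBasis (Fin 3) ℝ W) (a c : V) :
    inner ℝ (D a) (D c) =
      ⇑((o.toBasis.map D.symm).repr a) ⬝ᵥ ⇑((o.toBasis.map D.symm).repr c) := by
  rw [← o.repr.inner_map_map, PiLp.inner_apply, dotProduct]
  refine Finset.sum_congr rfl fun i _ => ?_
  simp [mul_comm]

/-- The stabilizer of the zero cubic is the whole rotation group. -/
theorem hasA4SymmetryAt_of_fundamentalCubic_eq_zero (hf : IsSpecialLagrangianImmersion f) {x : M}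
    (hC : ∀ a, fundamentalCubic f x a = 0) : HasA4SymmetryAt f x := by
  obtain ⟨o⟩ : Nonempty (OrthonormalBasis (Fin 3) ℝ (tangentPlane f x)) :=
    ⟨(stdOrthonormalBasis ℝ (tangentPlane f x)).reindex (finCongr (hf.specialLagrangian x).1)⟩
  obtain ⟨D, hD⟩ : ∃ D : TangentSpace (𝓡 3) x ≃ₗ[ℝ] tangentPlane f x,
      ∀ a, (D a : CThree) = differential f x a :=
    ⟨LinearEquiv.ofInjective (differential f x).toLinearMap (hf.immersive x), fun _ => rfl⟩
  have hg : ∀ a c, firstFundamentalForm f x a c =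
      ⇑((o.toBasis.map D.symm).repr a) ⬝ᵥ ⇑((o.toBasis.map D.symm).repr c) := fun a c => by
    rw [← inner_eq_dotProduct_repr, Submodule.coe_inner, hD, hD, firstFundamentalForm]
  obtain ⟨K, hK, h⟩ := exists_subgroup_alternatingGroup (o.toBasis.map D.symm)
  refine ⟨K, fun A hA => ⟨fun a c => ?_, (h A hA).1, fun a => by rw [hC, hC]⟩, hK⟩
  rw [hg, hg, (h A hA).2]

/-- An immersion into a plane has vanishing second fundamental form, hence vanishing cubic. -/
theorem fundamentalCubic_eq_zero_of_range_subset [IsManifold (𝓡 3) ∞ M]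
    (hf : IsSpecialLagrangianImmersion f) {P : AffineSubspace ℝ CThree}
    (hP : IsSpecialLagrangianPlane P) (hfP : Set.range f ⊆ (P : Set CThree)) (x : M)
    (a : TangentSpace (𝓡 3) x) : fundamentalCubic f x a = 0 := by
  set T := P.directionᗮ.starProjection with hT
  have hker : ∀ z, T z = 0 ↔ z ∈ P.direction := by
    intro z
    rw [hT, Submodule.starProjection_apply_eq_zero_iff, Submodule.orthogonal_orthogonal]
  have hconst : ∀ᶠ y in 𝓝 x, T (f y) = T (f x) := Eventually.of_forall fun y => by
    rw [← sub_eq_zero, ← map_sub, hker]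
    exact AffineSubspace.vsub_mem_direction (hfP ⟨y, rfl⟩) (hfP ⟨x, rfl⟩)
  obtain ⟨h1, h2⟩ := map_differential_eq_zero hf.smooth T hconst
  have hle : tangentPlane f x ≤ P.direction := by
    rintro _ ⟨v, rfl⟩
    exact (hker _).1 (h1 v)
  have heq : tangentPlane f x = P.direction :=
    Submodule.eq_of_le_of_finrank_eq hle (by rw [(hf.specialLagrangian x).1, hP.2.1])
  have hII : secondFundamentalForm f x a a = 0 := by
    rw [secondFundamentalForm, Submodule.starProjection_apply_eq_zero_iff,
      Submodule.orthogonal_orthogonal, heq]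
    exact (hker _).1 (h2 a a)
  rw [fundamentalCubic, hII, inner_zero_left]

end Converse

end SpecialLagrangian

theorem mainTheorem3 {M : Type*} [TopologicalSpace M] [ChartedSpace SpecialLagrangian.RThree M]
    [IsManifold (𝓡 3) ∞ M] [ConnectedSpace M]
    (f : M → SpecialLagrangian.CThree) (hf : SpecialLagrangian.IsSpecialLagrangianImmersion f) :
    (∀ x : M, SpecialLagrangian.HasA4SymmetryAt f x) ↔
      ∃ P : AffineSubspace ℝ SpecialLagrangian.CThree,
        SpecialLagrangian.IsSpecialLagrangianPlane P ∧
        Set.range f ⊆ (P : Set SpecialLagrangian.CThree) ∧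
        IsOpen {p : P | (p : SpecialLagrangian.CThree) ∈ Set.range f} := by
  constructor
  · intro hA
    exact SpecialLagrangian.exists_plane_of_fundamentalCubic_eq_zero hf
      (SpecialLagrangian.fundamentalCubic_eq_zero hf hA)
  · rintro ⟨P, hP, hfP, -⟩ x
    exact SpecialLagrangian.hasA4SymmetryAt_of_fundamentalCubic_eq_zero hf
      (SpecialLagrangian.fundamentalCubic_eq_zero_of_range_subset hf hP hfP x)
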